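/- Let $M=\mathbb H^2/G$ and $N=\mathbb H^2/G'$ be closed hyperbolic surfaces (curvature $-1$), where $G,G'\subset PSL_2(\mathbb R)$ are discrete groups acting freely and cocompactly on the hyperbolic plane $\mathbb H^2$. For such a group $G$, let $G^{(2)}$ be the subgroup generated by the squares of elements of $G$; the invariant trace field of $\mathbb H^2/G$ is the field $\mathbb Q(\mathrm{tr}\, g : g\in G^{(2)})\subset\mathbb R$ (it does not depend on the signs chosen for the traces). The surface $\mathbb H^2/G$ is called arithmetic if there are a totally real number field $K\subset\mathbb R$, a quaternion algebra $A$ over $K$, a $K$-algebra homomorphism $\rho:A\to M_2(\mathbb R)$ (so that $A$ is split at the identity embedding of $K$) and an order $\mathcal O\subset A$ over the ring of integers of $K$, such that $A$ is ramified at every real embedding of $K$ other than the identity, and $G$ is commensurable with the image in $PSL_2(\mathbb R)$ of $\rho(\mathcal O^1)$, where $\mathcal O^1$ is the group of elements of $\mathcal O$ of reduced norm $1$. Suppose that $M$ and $N$ are arithmetic and have the same invariant trace field, as subfields of $\mathbb R$. Then there is a constant $c>0$, depending only on $M$ and $N$, such that whenever $l$ is the length of a closed geodesic in $M$, $l'$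 is the length of a closed geodesic in $N$, and $l>l'$, we have $$\frac{l}{l'}\ \ge\ 1+c\,e^{-2l}.$$ -/

import Mathlib

open scoped MatrixGroups Quaternion

/-- A closed hyperbolic surface `M = ℍ / G`, where `G` is the image in `PSL(2, ℝ)` of a discrete
subgroup `Γ` of `SL(2, ℝ)` such that `G` acts freely and cocompactly on the upper half-plane
(the curvature `-1` metric on `ℍ` is Mathlib's metric). The group `Γ` may or may not
contain `-1`. -/
structure ClosedHyperbolicSurface where
  /-- The Fuchsian group, as a group of matrices. -/
  Γ : Subgroup SL(2, ℝ)
  discrete : DiscreteTopology Γ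
  free : ∀ g ∈ Γ, ∀ z : UpperHalfPlane, g • z = z → g = 1 ∨ g = -1
  cocompact : CompactSpace (MulAction.orbitRel.Quotient Γ UpperHalfPlane)

namespace ClosedHyperbolicSurface

/-- The points of the surface: `ℍ / Γ`. -/
abbrev Point (M : ClosedHyperbolicSurface) : Type :=
  MulAction.orbitRel.Quotient M.Γ UpperHalfPlane

/-- The universal covering map `ℍ → M`. -/
noncomputable def proj (M : ClosedHyperbolicSurface) (z : UpperHalfPlane) : M.Point := Quotient.mk _ z

/-- `l` is the length of a closed geodesic of `M`: some unit-speed geodesic of `M`, i.e. the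
projection to `M` of an isometrically embedded line `γ : ℝ → ℍ`, is periodic with period `l > 0`.
The closed geodesic is not required to be simple or primitive. -/
def IsGeodesicLength (M : ClosedHyperbolicSurface) (l : ℝ) : Prop :=
  0 < l ∧ ∃ γ : ℝ → UpperHalfPlane, Isometry γ ∧ ∀ t : ℝ, M.proj (γ (t + l)) = M.proj (γ t)

end ClosedHyperbolicSurface

/-- The invariant trace field `ℚ(tr g : g ∈ Γ⁽²⁾)` as a subfield of `ℝ`, where `Γ⁽²⁾` is the
subgroup generated by the squares of the elements of `Γ`. -/
noncomputable def invariantTraceField (Γ : Subgroup SL(2, ℝ)) : IntermediateField ℚ ℝ :=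
  IntermediateField.adjoin ℚ
    {t : ℝ | ∃ g ∈ Subgroup.closure {h : SL(2, ℝ) | ∃ x ∈ Γ, h = x ^ 2},
      t = Matrix.trace (g : Matrix (Fin 2) (Fin 2) ℝ)}

/-- An `𝓞 K`-order in the quaternion algebra `(a, b / K)`: a subring containing `𝓞 K` that is a
finitely generated `𝓞 K`-module and spans the algebra over `K`. -/
def IsQuaternionOrder {K : Type} [Field K] {a b : K}
    (O : Subalgebra (NumberField.RingOfIntegers K) ℍ[K,a,b]) : Prop :=
  (Subalgebra.toSubmodule O).FG ∧ Submodule.span K (O : Set ℍ[K,a,b]) = ⊤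

/-- The group `ρ(O¹)`, where `O¹` is the group of units of `O` of reduced norm `x * star x = 1`, and
`ρ` is a `K`-algebra homomorphism to `M₂(ℝ)`. (As `det (ρ x)` is the reduced norm of `x`, the
group `ρ(O¹)` lies in `SL(2, ℝ)`.) -/
def normOneImage {K : IntermediateField ℚ ℝ} {a b : K}
    (O : Subalgebra (NumberField.RingOfIntegers K) ℍ[K,a,b])
    (ρ : ℍ[K,a,b] →ₐ[K] Matrix (Fin 2) (Fin 2) ℝ) : Subgroup SL(2, ℝ) where
  carrier := {g | ∃ u : Oˣ, ((u : O) : ℍ[K,a,b]) * star ((u : O) : ℍ[K,a,b]) = 1 ∧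
    ρ ((u : O) : ℍ[K,a,b]) = (g : Matrix (Fin 2) (Fin 2) ℝ)}
  one_mem' := ⟨1, by simp, by simp⟩
  mul_mem' := by
    rintro g h ⟨u, hu, hg⟩ ⟨v, hv, hh⟩
    refine ⟨u * v, ?_, by simp [hg, hh]⟩
    have : ((u : O) : ℍ[K,a,b]) * (v : O) * star (((u : O) : ℍ[K,a,b]) * (v : O)) =
        (u : O) * (((v : O) : ℍ[K,a,b]) * star ((v : O) : ℍ[K,a,b])) *
          star ((u : O) : ℍ[K,a,b]) := by
      simp only [star_mul, mul_assoc]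
    simpa [hv, hu] using this
  inv_mem' := by
    rintro g ⟨u, hu, hg⟩
    have h1 : ((u⁻¹ : Oˣ) : O) * ((u : O) : ℍ[K,a,b]) = 1 := by
      have := congrArg (fun x : O => (x : ℍ[K,a,b])) u.inv_mul
      exact this
    have h2 : (((u⁻¹ : Oˣ) : O) : ℍ[K,a,b]) = star ((u : O) : ℍ[K,a,b]) :=
      left_inv_eq_right_inv h1 hu
    have h3 : star ((u : O) : ℍ[K,a,b]) * ((u : O) : ℍ[K,a,b]) = 1 := by rw [← h2, h1]
    refine ⟨u⁻¹, ?_, ?_⟩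
    · rw [h2, star_star, h3]
    · have e : ρ (((u⁻¹ : Oˣ) : O) : ℍ[K,a,b]) * (g : Matrix (Fin 2) (Fin 2) ℝ) = 1 := by
        rw [← hg, ← map_mul, h1, map_one]
      have e' : (g : Matrix (Fin 2) (Fin 2) ℝ) * ((g⁻¹ : SL(2, ℝ)) : Matrix (Fin 2) (Fin 2) ℝ)
          = 1 := by
        rw [← Matrix.SpecialLinearGroup.coe_mul, mul_inv_cancel, Matrix.SpecialLinearGroup.coe_one]
      exact left_inv_eq_right_inv e e'

/-- Arithmetic Fuchsian groups. `Γ` is arithmetic if there are a totally real number field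
`K ⊆ ℝ`, a quaternion algebra `A = (a, b / K)` that is split at the identity embedding of `K`
(through `ρ : A → M₂(ℝ)`) and ramified at every other real embedding of `K` (that is, the real
algebra obtained from `A` by base change is Hamilton's quaternion algebra), and an order `O` of
`A`, such that `Γ` is commensurable with `ρ(O¹)`. As `ρ` is arbitrary, this allows for
conjugation. -/
def IsArithmeticFuchsian (Γ : Subgroup SL(2, ℝ)) : Prop :=
  ∃ (K : IntermediateField ℚ ℝ) (a b : K)
    (O : Subalgebra (NumberField.RingOfIntegers K) ℍ[K,a,b])
    (ρ : ℍ[K,a,b] →ₐ[K] Matrix (Fin 2) (Fin 2) ℝ),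
    FiniteDimensional ℚ K ∧ NumberField.IsTotallyReal K ∧ a ≠ 0 ∧ b ≠ 0 ∧
    (∀ σ : K →+* ℝ, σ ≠ algebraMap K ℝ → Nonempty (ℍ[ℝ,σ a,σ b] ≃ₐ[ℝ] ℍ[ℝ])) ∧
    IsQuaternionOrder O ∧ Subgroup.Commensurable Γ (normOneImage O ρ)

namespace ClosedHyperbolicSurface

/-- The surface `ℍ / Γ` is arithmetic if its Fuchsian group is. -/
def IsArithmetic (M : ClosedHyperbolicSurface) : Prop := IsArithmeticFuchsian M.Γ

/-- The invariant trace field of the surface. -/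
noncomputable def traceField (M : ClosedHyperbolicSurface) : IntermediateField ℚ ℝ := invariantTraceField M.Γ

end ClosedHyperbolicSurface

/-! A closed geodesic of length `l` comes from a group element `x` with `tr (x ^ 2) = 2 cosh l`. For
an arithmetic surface this number is an algebraic integer of the invariant trace field `k`, and its
conjugates other than itself have absolute value at most `2` (`IsArithmetic.exists_eq_two_cosh`). If
`l > l'`, then `δ = 2 cosh l - 2 cosh l'` is a nonzero integer of `k` whose other conjugates are at
most `4`. Its norm is a nonzero rational integer, so `δ ≥ 4 ^ (1 - [k : ℚ])`. Since `δ ≤ (l - l') e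
^ l` and `l' ≤ e ^ l`, the gap follows.

The arithmetic input needs only `k ≤ K`, for `K` the field of definition (`traceField_le`). The
group spans `M₂(ℝ)` and each element has a power in the quaternion algebra `A`, so every element
normalizes `A`. A Skolem–Noether averaging then puts squares of group elements in `A`, and traces
from `A` lie in `K`. For the conjugates, a non-identity embedding of `k` extends to a non-identity
real embedding of `K`, where `A` is ramified. Norm-one elements have trace in `[-2, 2]` there, so
the conjugated eigenvalues of `x` lie on the unit circle (`norm_map_trace_sq_le`). -/

namespace UpperHalfPlane

/-! ### Geodesics of the upper half-plane and their translations -/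

theorem sl_smul_eq_iff (g : SL(2, ℝ)) (z w : UpperHalfPlane) :
    g • z = w ↔ (g 0 0 * z + g 0 1 : ℂ) = w * (g 1 0 * z + g 1 1) := by
  have hd : (g 1 0 * z + g 1 1 : ℂ) ≠ 0 := by
    have := UpperHalfPlane.denom_ne_zero (g : GL (Fin 2) ℝ) z
    simpa [UpperHalfPlane.denom] using this
  rw [UpperHalfPlane.ext_iff, UpperHalfPlane.coe_specialLinearGroup_apply]
  simp only [div_eq_iff hd, Algebra.algebraMap_self, RingHom.id_apply]

/-- Rotations about `I` move any point to the imaginary axis. -/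
theorem exists_smul_I_eq_and_re_eq_zero (z : UpperHalfPlane) :
    ∃ g : SL(2, ℝ), g • I = I ∧ (g • z).re = 0 := by
  -- The left side is a positive multiple of the real part of the image of `z` under the rotation
  -- matrix of angle `φ / 2`.
  obtain ⟨φ, hφ⟩ : ∃ φ : ℝ, Real.cos φ * (2 * z.re) +
      Real.sin φ * (1 - z.re ^ 2 - z.im ^ 2) = 0 := by
    by_cases hq : 1 - z.re ^ 2 - z.im ^ 2 = 0
    · exact ⟨Real.pi / 2, by simp [hq]⟩
    · refine ⟨Real.arctan (-(2 * z.re) / (1 - z.re ^ 2 - z.im ^ 2)), ?_⟩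
      have hc := Real.cos_arctan_pos (-(2 * z.re) / (1 - z.re ^ 2 - z.im ^ 2))
      have ht := Real.tan_arctan (-(2 * z.re) / (1 - z.re ^ 2 - z.im ^ 2))
      rw [Real.tan_eq_sin_div_cos, div_eq_div_iff hc.ne' hq] at ht
      linear_combination ht
  have h1 : Real.cos φ = Real.cos (φ / 2) ^ 2 - Real.sin (φ / 2) ^ 2 := by
    rw [← Real.cos_two_mul']; congr 1; ring
  have h2 : Real.sin φ = 2 * Real.sin (φ / 2) * Real.cos (φ / 2) := by
    rw [← Real.sin_two_mul]; congr 1; ring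
  have h3 := Real.sin_sq_add_cos_sq (φ / 2)
  rw [h1, h2] at hφ
  generalize Real.cos (φ / 2) = c at *
  generalize Real.sin (φ / 2) = s at *
  let g : SL(2, ℝ) := ⟨!![c, s; -s, c], by rw [Matrix.det_fin_two_of]; linear_combination h3⟩
  refine ⟨g, ?_, ?_⟩
  · rw [sl_smul_eq_iff]
    simp [g, Complex.ext_iff]
  · have := (sl_smul_eq_iff g z (g • z)).1 rfl
    have hre := congrArg Complex.re this
    have him := congrArg Complex.im this
    simp [g] at hre him
    have hpos : 0 < (-(s * z.re) + c) ^ 2 + (s * z.im) ^ 2 := by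
      have hz := z.im_pos
      by_cases hs : s = 0
      · have : c ≠ 0 := by rintro rfl; simp [hs] at h3
        have : 0 < c ^ 2 := by positivity
        simpa [hs] using this
      · have : 0 < (s * z.im) ^ 2 := by positivity
        positivity
    have : ((-(s * z.re) + c) ^ 2 + (s * z.im) ^ 2) * (g • z).re = 0 := by
      linear_combination -(-(s * z.re) + c) * hre + (s * z.im) * him + hφ / 2
    exact (mul_eq_zero.1 this).resolve_left hpos.ne'

/-- Any geodesic line can be moved to the imaginary axis. -/
theorem exists_smul_isometry_eq {γ : ℝ → UpperHalfPlane} (hγ : Isometry γ) :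
    ∃ h : SL(2, ℝ), ∀ t, (h • γ t).re = 0 ∧ (h • γ t).im = Real.exp t := by
  obtain ⟨h, h0, hre, him⟩ : ∃ h : SL(2, ℝ), h • γ 0 = I ∧ (h • γ 1).re = 0 ∧
      (h • γ 1).im = Real.exp 1 := by
    obtain ⟨h₀, e₀⟩ := MulAction.exists_smul_eq SL(2, ℝ) (γ 0) I
    obtain ⟨g, e₁, e₂⟩ := exists_smul_I_eq_and_re_eq_zero (h₀ • γ 1)
    have hd : dist ((g * h₀) • γ 1) I = 1 := by
      rw [← e₁, ← e₀, ← mul_smul, dist_smul, hγ.dist_eq]; simp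
    rw [← mul_smul] at e₂
    rw [dist_of_re_eq (by simpa using e₂), Real.dist_eq] at hd
    simp only [I_im, Real.log_one, sub_zero] at hd
    rcases eq_or_eq_neg_of_abs_eq hd with hl | hl
    · refine ⟨g * h₀, by rw [mul_smul, e₀, e₁], e₂, ?_⟩
      have := Real.exp_log (im_pos ((g * h₀) • γ 1))
      rw [← this, hl]
    -- The point at distance `1` landed below `I`; the half-turn about `I` sends it above.
    · let S : SL(2, ℝ) := ⟨!![0, -1; 1, 0], by simp⟩
      have hS : S • (g * h₀) • γ 1 = ⟨Complex.mk 0 (Real.exp 1), Real.exp_pos 1⟩ := by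
        have : ((g * h₀) • γ 1).im = Real.exp (-1) := by rw [← hl, Real.exp_log (im_pos _)]
        rw [sl_smul_eq_iff]
        have e₃ : Real.exp 1 * Real.exp (-1) = 1 := by rw [← Real.exp_add]; simp
        simp [S, Complex.ext_iff, e₂, this, e₃]
      refine ⟨S * (g * h₀), ?_, ?_, ?_⟩
      · rw [mul_smul, mul_smul, e₀, e₁, sl_smul_eq_iff]
        simp [S]
      · rw [mul_smul, hS]; rfl
      · rw [mul_smul, hS]; rfl
  refine ⟨h, fun t => ?_⟩
  have d0 : dist (h • γ t) (h • γ 0) = |t| := by rw [dist_smul, hγ.dist_eq]; simp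
  have d1 : dist (h • γ t) (h • γ 1) = |t - 1| := by rw [dist_smul, hγ.dist_eq, Real.dist_eq]
  have c0 := congrArg Real.cosh d0
  have c1 := congrArg Real.cosh d1
  rw [cosh_dist, Complex.dist_eq, ← Complex.normSq_eq_norm_sq, Complex.normSq_apply, Real.cosh_abs,
    Real.cosh_eq] at c0 c1
  simp only [Complex.sub_re, Complex.sub_im, coe_re, coe_im, hre, him, h0, I_re, I_im] at c0 c1
  generalize h • γ t = z at *
  have hz := z.im_pos
  generalize z.im = y at *
  generalize z.re = x at *
  have E : Real.exp (t - 1) = Real.exp t * Real.exp (-1) := by rw [← Real.exp_add]; rfl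
  have E' : Real.exp (-(t - 1)) = Real.exp (-t) * Real.exp 1 := by
    rw [← Real.exp_add]; congr 1; ring
  have e₃ : Real.exp 1 * Real.exp (-1) = 1 := by rw [← Real.exp_add]; simp
  have e₄ : Real.exp t * Real.exp (-t) = 1 := by rw [← Real.exp_add]; simp
  have h1 : 1 < Real.exp 1 := by simp
  rw [E, E'] at c1
  have ht := Real.exp_pos t
  generalize Real.exp t = p at *
  generalize Real.exp (-t) = p' at *
  generalize Real.exp 1 = s at *
  generalize Real.exp (-1) = s' at *
  have hs : 0 < s := by linarith
  field_simp at c0 c1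
  -- Eliminating `x` between the distances to `γ 0` and `γ 1` leaves an equation linear in `y`.
  have hy : y = p := by
    have : (s ^ 2 - 1) * (y - p) = 0 := by
      have : (s ^ 2 - 1) * (1 - y * p') = 0 := by linear_combination c1 - c0 + y * p * e₃
      linear_combination - p * this - y * (s^2-1) * e₄
    rcases mul_eq_zero.1 this with h | h
    · nlinarith
    · linarith
  subst hy
  refine ⟨?_, rfl⟩
  have : x ^ 2 = 0 := by linear_combination c0 + e₄
  simpa using this

end UpperHalfPlane

namespace Matrix.SpecialLinearGroup

/-- A matrix translating two points of the imaginary axis by `l` is diagonal. -/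
theorem eq_diag_of_smul {g : SL(2, ℝ)} {t₁ t₂ l : ℝ} (ht : t₁ ≠ t₂) {z₁ z₂ w₁ w₂ : UpperHalfPlane}
    (hz₁ : z₁.re = 0 ∧ z₁.im = Real.exp t₁) (hz₂ : z₂.re = 0 ∧ z₂.im = Real.exp t₂)
    (hw₁ : w₁.re = 0 ∧ w₁.im = Real.exp (t₁ + l)) (hw₂ : w₂.re = 0 ∧ w₂.im = Real.exp (t₂ + l))
    (h₁ : g • z₁ = w₁) (h₂ : g • z₂ = w₂) :
    g 1 0 = 0 ∧ g 0 1 = 0 ∧ g 0 0 * g 1 1 = 1 ∧ g 0 0 ^ 2 = Real.exp l := by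
  rw [UpperHalfPlane.sl_smul_eq_iff] at h₁ h₂
  have r₁ := congrArg Complex.re h₁
  have i₁ := congrArg Complex.im h₁
  have r₂ := congrArg Complex.re h₂
  have i₂ := congrArg Complex.im h₂
  simp [hz₁, hz₂, hw₁, hw₂, Real.exp_add] at r₁ i₁ r₂ i₂
  have hs : Real.exp t₁ ≠ Real.exp t₂ := fun h => ht (Real.exp_injective h)
  have p₁ := Real.exp_pos t₁
  have p₂ := Real.exp_pos t₂
  have p₃ := Real.exp_pos l
  have hdet : g 0 0 * g 1 1 - g 0 1 * g 1 0 = 1 := by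
    have := g.det_coe
    rwa [Matrix.det_fin_two] at this
  -- The real parts say `g 0 1 = -exp (l + 2 * tᵢ) * g 1 0` for two different `tᵢ`.
  have hc : g 1 0 = 0 := by
    have : (Real.exp l * (Real.exp t₁ + Real.exp t₂) * (Real.exp t₁ - Real.exp t₂)) * g 1 0 = 0 := by
      linear_combination r₁ - r₂
    refine (mul_eq_zero.1 this).resolve_left ?_
    exact mul_ne_zero (by positivity) (sub_ne_zero.2 hs)
  have hb : g 0 1 = 0 := by rw [r₁, hc]; simp
  have ha : g 0 0 = Real.exp l * g 1 1 := by
    apply mul_right_cancel₀ p₁.ne'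
    rw [i₁]; ring
  refine ⟨hc, hb, by simpa [hb, hc] using hdet, ?_⟩
  rw [hb, hc] at hdet
  linear_combination g 0 0 * ha + Real.exp l * hdet

end Matrix.SpecialLinearGroup

/-! ### Closed geodesics and hyperbolic elements -/

namespace ClosedHyperbolicSurface

theorem countable (M : ClosedHyperbolicSurface) : Countable M.Γ := by
  have := M.discrete
  have : SecondCountableTopology SL(2, ℝ) :=
    have : SecondCountableTopology (Matrix (Fin 2) (Fin 2) ℝ) :=
      inferInstanceAs (SecondCountableTopology (Fin 2 → Fin 2 → ℝ))
    TopologicalSpace.Subtype.secondCountableTopology {A : Matrix (Fin 2) (Fin 2) ℝ | A.det = 1}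
  exact TopologicalSpace.separableSpace_iff_countable.1 inferInstance

/-- A closed geodesic of length `l` comes from a hyperbolic element of the Fuchsian group. -/
theorem IsGeodesicLength.exists_diag {M : ClosedHyperbolicSurface} {l : ℝ}
    (hl : M.IsGeodesicLength l) :
    ∃ g ∈ M.Γ, ∃ h : SL(2, ℝ), (h * g * h⁻¹) 1 0 = 0 ∧ (h * g * h⁻¹) 0 1 = 0 ∧
      (h * g * h⁻¹) 0 0 * (h * g * h⁻¹) 1 1 = 1 ∧ (h * g * h⁻¹) 0 0 ^ 2 = Real.exp l := by
  obtain ⟨-, γ, hγ, hp⟩ := hl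
  have key : ∀ t, ∃ g : M.Γ, g • γ t = γ (t + l) := fun t => by
    have := Quotient.exact (hp t)
    exact this
  choose f hf using key
  have := M.countable
  -- The group element carrying `γ t` to `γ (t + l)` could depend on `t`. As `ℝ` is uncountable, one
  -- element serves two times, and this already makes it diagonal along the geodesic.
  obtain ⟨t₁, t₂, h12, hne⟩ : ∃ t₁ t₂, f t₁ = f t₂ ∧ t₁ ≠ t₂ := by
    have : ¬ Function.Injective f := not_injective_uncountable_countable f
    simpa [Function.Injective] using this
  obtain ⟨h, hh⟩ := UpperHalfPlane.exists_smul_isometry_eq hγ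
  refine ⟨f t₁, (f t₁).2, h, Matrix.SpecialLinearGroup.eq_diag_of_smul hne (hh t₁) (hh t₂)
    (hh (t₁ + l)) (hh (t₂ + l)) ?_ ?_⟩
  · rw [← hf t₁, mul_smul, mul_smul, inv_smul_smul]; rfl
  · rw [← hf t₂, mul_smul, mul_smul, inv_smul_smul, h12]; rfl

end ClosedHyperbolicSurface

/-! ### Conjugation, generation and powers of two-by-two matrices -/

namespace Matrix

/-- Conjugation by an element of `SL(2, ℝ)`. -/
def slConj (h : SL(2, ℝ)) : Matrix (Fin 2) (Fin 2) ℝ →ₐ[ℝ] Matrix (Fin 2) (Fin 2) ℝ :=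
  AlgHom.ofLinearMap
    (LinearMap.mulLeft ℝ (h : Matrix (Fin 2) (Fin 2) ℝ) ∘ₗ
      LinearMap.mulRight ℝ ((h⁻¹ : SL(2, ℝ)) : Matrix (Fin 2) (Fin 2) ℝ))
    (by
      rw [LinearMap.comp_apply, LinearMap.mulRight_apply, LinearMap.mulLeft_apply, one_mul,
        ← SpecialLinearGroup.coe_mul, mul_inv_cancel, SpecialLinearGroup.coe_one])
    (fun x y => by
      have : ((h⁻¹ : SL(2, ℝ)) : Matrix (Fin 2) (Fin 2) ℝ) * h = 1 := by
        rw [← SpecialLinearGroup.coe_mul, inv_mul_cancel, SpecialLinearGroup.coe_one]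
      simp only [LinearMap.comp_apply, LinearMap.mulLeft_apply, LinearMap.mulRight_apply]
      calc _ = (h : Matrix (Fin 2) (Fin 2) ℝ) * (x * 1 * y * (h⁻¹ : SL(2, ℝ))) := by simp
        _ = _ := by rw [← this]; simp only [Matrix.mul_assoc])

theorem slConj_apply (h : SL(2, ℝ)) (m : Matrix (Fin 2) (Fin 2) ℝ) :
    slConj h m = h * m * (h⁻¹ : SL(2, ℝ)) := by
  simp [slConj, Matrix.mul_assoc]

theorem slConj_coe (h g : SL(2, ℝ)) :
    slConj h g = ((h * g * h⁻¹ : SL(2, ℝ)) : Matrix (Fin 2) (Fin 2) ℝ) := by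
  rw [slConj_apply, SpecialLinearGroup.coe_mul, SpecialLinearGroup.coe_mul]

theorem slConj_slConj_inv (h : SL(2, ℝ)) (m : Matrix (Fin 2) (Fin 2) ℝ) :
    slConj h (slConj h⁻¹ m) = m := by
  have : (h : Matrix (Fin 2) (Fin 2) ℝ) * (h⁻¹ : SL(2, ℝ)) = 1 := by
    rw [← SpecialLinearGroup.coe_mul, mul_inv_cancel, SpecialLinearGroup.coe_one]
  rw [slConj_apply, slConj_apply, inv_inv, ← Matrix.mul_assoc, ← Matrix.mul_assoc, this,
    Matrix.one_mul, Matrix.mul_assoc, this, Matrix.mul_one]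

theorem slConj_inv_slConj (h : SL(2, ℝ)) (m : Matrix (Fin 2) (Fin 2) ℝ) :
    slConj h⁻¹ (slConj h m) = m := by
  simpa using slConj_slConj_inv h⁻¹ m

/-- A subalgebra of `M₂(ℝ)` which contains a non-scalar diagonal matrix, a matrix which is not
upper triangular and one which is not lower triangular is everything. -/
theorem subalgebra_eq_top_of_diag {A : Subalgebra ℝ (Matrix (Fin 2) (Fin 2) ℝ)}
    {x y z : Matrix (Fin 2) (Fin 2) ℝ} (hx : x ∈ A) (hy : y ∈ A) (hz : z ∈ A)
    (h10 : x 1 0 = 0) (h01 : x 0 1 = 0) (hne : x 0 0 ≠ x 1 1) (hy' : y 1 0 ≠ 0) (hz' : z 0 1 ≠ 0) :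
    A = ⊤ := by
  have hd : x 0 0 - x 1 1 ≠ 0 := sub_ne_zero.2 hne
  have e11 : !![1, 0; 0, 0] ∈ A := by
    have := A.smul_mem (A.sub_mem hx (A.smul_mem A.one_mem (x 1 1))) (x 0 0 - x 1 1)⁻¹
    convert this using 1
    ext i j; fin_cases i <;> fin_cases j <;> simp [h10, h01, hd]
  have e22 : !![0, 0; 0, 1] ∈ A := by
    convert A.sub_mem A.one_mem e11 using 1
    ext i j; fin_cases i <;> fin_cases j <;> simp
  have e21 : !![0, 0; 1, 0] ∈ A := by
    convert A.smul_mem (A.mul_mem (A.mul_mem e22 hy) e11) (y 1 0)⁻¹ using 1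
    ext i j; fin_cases i <;> fin_cases j <;> simp [Matrix.mul_apply, Matrix.vecMul, vecHead, vecTail, hy']
  have e12 : !![0, 1; 0, 0] ∈ A := by
    convert A.smul_mem (A.mul_mem (A.mul_mem e11 hz) e22) (z 0 1)⁻¹ using 1
    ext i j; fin_cases i <;> fin_cases j <;> simp [Matrix.mul_apply, Matrix.vecMul, vecHead, hz']
  refine eq_top_iff.2 fun m _ => ?_
  have := A.add_mem (A.add_mem (A.smul_mem e11 (m 0 0)) (A.smul_mem e12 (m 0 1)))
    (A.add_mem (A.smul_mem e21 (m 1 0)) (A.smul_mem e22 (m 1 1)))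
  convert this using 1
  ext i j; fin_cases i <;> fin_cases j <;> simp

namespace SpecialLinearGroup

theorem det_eq (g : SL(2, ℝ)) : g 0 0 * g 1 1 - g 0 1 * g 1 0 = 1 := by
  have := g.det_coe
  rwa [Matrix.det_fin_two] at this

theorem sq_eq (g : SL(2, ℝ)) :
    (g : Matrix (Fin 2) (Fin 2) ℝ) ^ 2 = (g 0 0 + g 1 1) • (g : Matrix (Fin 2) (Fin 2) ℝ) - 1 := by
  have := g.det_eq
  rw [sq]
  ext i j
  fin_cases i <;> fin_cases j <;> simp [Matrix.mul_apply] <;>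
    first | ring1 | linear_combination - this

/-- By Cayley–Hamilton the coefficients satisfy a recursion with multiplier the trace. As this is at
least `2` in absolute value, they grow by at least `1` at each step, so the coefficient of `g` never
vanishes. -/
theorem exists_pow_eq (g : SL(2, ℝ)) (hg : 4 ≤ (g 0 0 + g 1 1) ^ 2) (n : ℕ) :
    ∃ u u' : ℝ, |u| + 1 ≤ |u'| ∧
      (g : Matrix (Fin 2) (Fin 2) ℝ) ^ (n + 1) =
        u' • (g : Matrix (Fin 2) (Fin 2) ℝ) - u • 1 := by
  induction n with
  | zero => exact ⟨0, 1, by simp, by simp⟩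
  | succ n ih =>
    obtain ⟨u, u', h, h'⟩ := ih
    refine ⟨u', (g 0 0 + g 1 1) * u' - u, ?_, ?_⟩
    · have h2 : 2 ≤ |g 0 0 + g 1 1| := by
        have := sq_abs (g 0 0 + g 1 1)
        nlinarith [abs_nonneg (g 0 0 + g 1 1)]
      have h3 := abs_sub_abs_le_abs_sub ((g 0 0 + g 1 1) * u') u
      rw [abs_mul] at h3
      nlinarith [abs_nonneg u']
    · rw [pow_succ, h', sub_mul, smul_mul_assoc, ← sq, sq_eq, smul_mul_assoc, one_mul]
      module

/-- A non-elliptic matrix is a linear combination of the identity and any of its powers. -/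
theorem exists_eq_smul_pow_add (g : SL(2, ℝ)) (hg : 4 ≤ (g 0 0 + g 1 1) ^ 2) {n : ℕ} (hn : 0 < n) :
    ∃ u v : ℝ, (g : Matrix (Fin 2) (Fin 2) ℝ) =
      u • (g : Matrix (Fin 2) (Fin 2) ℝ) ^ n + v • 1 := by
  obtain ⟨n, rfl⟩ := Nat.exists_eq_succ_of_ne_zero hn.ne'
  obtain ⟨u, u', h, h'⟩ := exists_pow_eq g hg n
  have hu : u' ≠ 0 := by
    rintro rfl
    have := abs_nonneg u
    simp at h
    linarith
  refine ⟨u'⁻¹, u'⁻¹ * u, ?_⟩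
  rw [Nat.succ_eq_add_one, h', smul_sub, smul_smul, smul_smul, inv_mul_cancel₀ hu, one_smul,
    sub_add_cancel]

/-- An elliptic matrix has a fixed point. -/
theorem exists_smul_eq_self (g : SL(2, ℝ)) (hg : (g 0 0 + g 1 1) ^ 2 < 4) :
    ∃ z : UpperHalfPlane, g • z = z := by
  have hell : (g : GL (Fin 2) ℝ).IsElliptic := by
    have := g.det_eq
    change Matrix.discr (g : Matrix (Fin 2) (Fin 2) ℝ) < 0
    rw [Matrix.discr_fin_two, Matrix.trace_fin_two, g.det_coe]
    linarith
  exact ⟨UpperHalfPlane.fixedPt _ hell,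
    (UpperHalfPlane.gl_smul_eq_self_iff_eq_fixedPt (by simp) hell).2 rfl⟩

theorem mul_apply_two (g h : SL(2, ℝ)) (i j : Fin 2) :
    (g * h) i j = g i 0 * h 0 j + g i 1 * h 1 j := by
  rw [coe_mul, Matrix.mul_apply, Fin.sum_univ_two]

theorem inv_apply_two (g : SL(2, ℝ)) :
    g⁻¹ 0 0 = g 1 1 ∧ g⁻¹ 0 1 = - g 0 1 ∧ g⁻¹ 1 0 = - g 1 0 ∧ g⁻¹ 1 1 = g 0 0 := by
  rw [coe_inv, Matrix.adjugate_fin_two]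
  simp

theorem ext_two {g h : SL(2, ℝ)} (h00 : g 0 0 = h 0 0) (h01 : g 0 1 = h 0 1) (h10 : g 1 0 = h 1 0)
    (h11 : g 1 1 = h 1 1) : g = h := by
  ext i j
  fin_cases i <;> fin_cases j <;> assumption

/-- The unipotent upper triangular matrices. -/
def upperUnipotent (t : ℝ) : SL(2, ℝ) := ⟨!![1, t; 0, 1], by simp⟩

theorem upperUnipotent_apply (t : ℝ) : upperUnipotent t 0 0 = 1 ∧ upperUnipotent t 0 1 = t ∧
    upperUnipotent t 1 0 = 0 ∧ upperUnipotent t 1 1 = 1 := by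
  simp [upperUnipotent]

theorem continuous_upperUnipotent : Continuous upperUnipotent := by
  refine Continuous.subtype_mk ?_ _
  refine continuous_matrix fun i j => ?_
  fin_cases i <;> fin_cases j <;> simp <;> fun_prop

end SpecialLinearGroup

end Matrix

/-! ### Cocompact groups span the matrix algebra -/

namespace ClosedHyperbolicSurface

open Filter Topology Matrix Matrix.SpecialLinearGroup

theorem four_le_trace_sq (M : ClosedHyperbolicSurface) {g : SL(2, ℝ)} (hg : g ∈ M.Γ) :
    4 ≤ (g 0 0 + g 1 1) ^ 2 := by
  by_contra! h
  obtain ⟨z, hz⟩ := exists_smul_eq_self g h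
  rcases M.free g hg z hz with rfl | rfl <;> norm_num at h

/-- A continuous invariant function on `ℍ` is bounded. -/
theorem exists_bound (M : ClosedHyperbolicSurface) {F : UpperHalfPlane → ℝ} (hF : Continuous F)
    (hinv : ∀ g ∈ M.Γ, ∀ z, F (g • z) = F z) : ∃ C, ∀ z, F z ≤ C := by
  have := M.cocompact
  let G : M.Point → ℝ := Quotient.lift F (by
    rintro a b ⟨g, rfl⟩
    exact hinv g g.2 b)
  have hG : Continuous G := hF.quotient_lift _
  obtain ⟨C, hC⟩ := (isCompact_range hG).bddAbove
  exact ⟨C, fun z => hC ⟨M.proj z, rfl⟩⟩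

/-- If a conjugate of the group contains the diagonal matrix `diag(p, p⁻¹)` with `p² > 1`, then it
is not upper triangular. -/
theorem exists_apply_one_zero_ne_zero_of_one_lt (M : ClosedHyperbolicSurface) {x h : SL(2, ℝ)}
    (hx : x ∈ M.Γ)
    (h10 : (h * x * h⁻¹) 1 0 = 0) (h01 : (h * x * h⁻¹) 0 1 = 0)
    (hp : 1 < (h * x * h⁻¹) 0 0 ^ 2) : ∃ g ∈ M.Γ, (h * g * h⁻¹) 1 0 ≠ 0 := by
  by_contra! H
  have hdet := det_eq (h * x * h⁻¹)
  rw [h10, mul_zero, sub_zero] at hdet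
  -- The commutator of two upper triangular elements is unipotent, and conjugation by powers of `x`
  -- contracts it to `1`. Discreteness makes it trivial, so each `g` is diagonal along with `x`.
  have hdiag : ∀ g ∈ M.Γ, (h * g * h⁻¹) 0 1 = 0 := by
    intro g hg
    have hg10 := H g hg
    have hgdet := det_eq (h * g * h⁻¹)
    rw [hg10, mul_zero, sub_zero] at hgdet
    set X := h * x * h⁻¹ with hX
    set Y := h * g * h⁻¹ with hY
    set β := X 1 1 * Y 1 1 * Y 0 1 * (X 0 0 - X 1 1) with hβ
    have hu : X⁻¹ * Y⁻¹ * X * Y = upperUnipotent β := by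
      apply ext_two <;> simp only [mul_apply_two, inv_apply_two, upperUnipotent_apply, h10, h01, hg10]
      · linear_combination X 0 0 * X 1 1 * hgdet + hdet
      · ring
      · ring
      · linear_combination X 0 0 * X 1 1 * hgdet + hdet
    have hpow : ∀ n : ℕ, X⁻¹ ^ n * upperUnipotent β * X ^ n =
        upperUnipotent ((X 1 1 ^ 2) ^ n * β) := by
      intro n
      induction n with
      | zero => simp
      | succ n ih =>
        rw [pow_succ', pow_succ, show X⁻¹ * X⁻¹ ^ n * upperUnipotent β * (X ^ n * X) =
          X⁻¹ * (X⁻¹ ^ n * upperUnipotent β * X ^ n) * X by group, ih]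
        apply ext_two <;> simp only [mul_apply_two, inv_apply_two, upperUnipotent_apply, h10, h01]
        · linear_combination hdet
        · ring
        · ring
        · linear_combination hdet
    let z : ℕ → SL(2, ℝ) := fun n => x⁻¹ ^ n * (x⁻¹ * g⁻¹ * x * g) * x ^ n
    have hzΓ : ∀ n, z n ∈ M.Γ := fun n =>
      mul_mem (mul_mem (pow_mem (inv_mem hx) _)
        (mul_mem (mul_mem (mul_mem (inv_mem hx) (inv_mem hg)) hx) hg)) (pow_mem hx _)
    have hz : ∀ n, z n = h⁻¹ * upperUnipotent ((X 1 1 ^ 2) ^ n * β) * h := by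
      intro n
      have e1 : X⁻¹ ^ n = h * x⁻¹ ^ n * h⁻¹ := by rw [hX, ← conj_pow]; congr 1; group
      have e2 : X ^ n = h * x ^ n * h⁻¹ := by rw [hX, ← conj_pow]
      rw [← hpow, ← hu, e1, e2, hX, hY]
      simp only [z]
      group
    have hlim : Tendsto z atTop (𝓝 1) := by
      have hq : X 1 1 ^ 2 < 1 := by
        have : X 0 0 ^ 2 * X 1 1 ^ 2 = 1 := by rw [← mul_pow, hdet, one_pow]
        nlinarith [sq_nonneg (X 1 1)]
      have h1 : Tendsto (fun n : ℕ => (X 1 1 ^ 2) ^ n * β) atTop (𝓝 (0 * β)) :=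
        (tendsto_pow_atTop_nhds_zero_of_lt_one (sq_nonneg _) hq).mul_const β
      have hc : Continuous fun t => h⁻¹ * upperUnipotent t * h :=
        (continuous_const.mul continuous_upperUnipotent).mul continuous_const
      have h2 := (hc.tendsto (0 * β)).comp h1
      have h0 : upperUnipotent (0 * β) = 1 := by
        ext i j; fin_cases i <;> fin_cases j <;> simp [upperUnipotent]
      simp only [h0, mul_one, inv_mul_cancel] at h2
      exact h2.congr fun n => (hz n).symm
    have hev : ∀ᶠ n in atTop, z n = 1 := by
      have := M.discrete
      have hlim' : Tendsto (fun n => (⟨z n, hzΓ n⟩ : M.Γ)) atTop (𝓝 1) :=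
        tendsto_subtype_rng.2 hlim
      rw [nhds_discrete, tendsto_pure] at hlim'
      exact hlim'.mono fun n hn => congrArg Subtype.val hn
    obtain ⟨n, hn⟩ := hev.exists
    have h1 : upperUnipotent ((X 1 1 ^ 2) ^ n * β) = 1 := by
      have := hz n
      rw [hn] at this
      calc _ = h * (h⁻¹ * upperUnipotent ((X 1 1 ^ 2) ^ n * β) * h) * h⁻¹ := by group
        _ = 1 := by rw [← this]; group
    have h2 : (X 1 1 ^ 2) ^ n * β = 0 := by
      have := congrArg (fun m : SL(2, ℝ) => m 0 1) h1
      simpa [upperUnipotent] using this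
    have hX1 : X 1 1 ≠ 0 := right_ne_zero_of_mul (hdet ▸ one_ne_zero)
    have hY1 : Y 1 1 ≠ 0 := right_ne_zero_of_mul (hgdet ▸ one_ne_zero)
    have hXX : X 0 0 - X 1 1 ≠ 0 := by
      intro h
      rw [sub_eq_zero] at h
      rw [← h] at hdet
      nlinarith
    have h3 := (mul_eq_zero.1 h2).resolve_left (pow_ne_zero _ (pow_ne_zero _ hX1))
    exact (mul_eq_zero.1 ((mul_eq_zero.1 h3).resolve_right hXX)).resolve_left
      (mul_ne_zero hX1 hY1)
  -- For a diagonal group `re / im` is an invariant continuous function that is unbounded, against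
  -- compactness of the quotient.
  obtain ⟨C, hC⟩ := M.exists_bound (F := fun z => (h • z).re / (h • z).im)
    (by
      have hc : Continuous fun z : UpperHalfPlane => h • z := (isometry_smul _ h).continuous
      exact (UpperHalfPlane.continuous_re.comp hc).div (UpperHalfPlane.continuous_im.comp hc)
        fun z => (UpperHalfPlane.im_pos _).ne')
    (by
      intro g hg z
      have e : h • g • z = (h * g * h⁻¹) • (h • z) := by simp only [← mul_smul]; group
      have hd := hdiag g hg
      have h1 := H g hg
      have hgdet := det_eq (h * g * h⁻¹)
      rw [h1, mul_zero, sub_zero] at hgdet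
      have := (UpperHalfPlane.sl_smul_eq_iff (h * g * h⁻¹) (h • z) _).1 rfl
      rw [← e] at this
      generalize h * g * h⁻¹ = Y at *
      have hre := congrArg Complex.re this
      have him := congrArg Complex.im this
      simp only [hd, h1] at hre him
      simp at hre him
      have hY1 : Y 1 1 ≠ 0 := right_ne_zero_of_mul (hgdet ▸ one_ne_zero)
      rw [div_eq_div_iff (UpperHalfPlane.im_pos _).ne' (UpperHalfPlane.im_pos _).ne']
      apply mul_right_cancel₀ hY1
      linear_combination (h • z).re * him - (h • z).im * hre)
  have := hC (h⁻¹ • ⟨⟨C + 1, 1⟩, one_pos⟩)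
  simp only [smul_inv_smul] at this
  simp [UpperHalfPlane.re, UpperHalfPlane.im] at this
  linarith

/-- If a conjugate of the group contains a diagonal matrix `diag(p, p⁻¹)` with `p² ≠ 1`, then it
is not upper triangular. -/
theorem exists_apply_one_zero_ne_zero (M : ClosedHyperbolicSurface) {x h : SL(2, ℝ)}
    (hx : x ∈ M.Γ)
    (h10 : (h * x * h⁻¹) 1 0 = 0) (h01 : (h * x * h⁻¹) 0 1 = 0)
    (hp : (h * x * h⁻¹) 0 0 ^ 2 ≠ 1) : ∃ g ∈ M.Γ, (h * g * h⁻¹) 1 0 ≠ 0 := by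
  rcases lt_or_gt_of_ne hp with hlt | hgt
  · have hinv : h * x⁻¹ * h⁻¹ = (h * x * h⁻¹)⁻¹ := by group
    refine M.exists_apply_one_zero_ne_zero_of_one_lt (inv_mem hx) (h := h) ?_ ?_ ?_
    · rw [hinv, (inv_apply_two _).2.2.1, h10, neg_zero]
    · rw [hinv, (inv_apply_two _).2.1, h01, neg_zero]
    · have hdet := det_eq (h * x * h⁻¹)
      rw [h10, mul_zero, sub_zero] at hdet
      rw [hinv, (inv_apply_two _).1]
      have : (h * x * h⁻¹) 0 0 ^ 2 * (h * x * h⁻¹) 1 1 ^ 2 = 1 := by rw [← mul_pow, hdet, one_pow]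
      nlinarith [sq_nonneg ((h * x * h⁻¹) 1 1), sq_nonneg ((h * x * h⁻¹) 0 0)]
  · exact M.exists_apply_one_zero_ne_zero_of_one_lt hx h10 h01 hgt

/-- Conjugation by the Weyl element `w` exchanges upper and lower triangular matrices. -/
theorem exists_apply_zero_one_ne_zero (M : ClosedHyperbolicSurface) {x h : SL(2, ℝ)}
    (hx : x ∈ M.Γ)
    (h10 : (h * x * h⁻¹) 1 0 = 0) (h01 : (h * x * h⁻¹) 0 1 = 0)
    (hp : (h * x * h⁻¹) 0 0 ^ 2 ≠ 1) : ∃ g ∈ M.Γ, (h * g * h⁻¹) 0 1 ≠ 0 := by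
  let w : SL(2, ℝ) := ⟨!![0, -1; 1, 0], by simp⟩
  have hw00 : w 0 0 = 0 := rfl
  have hw01 : w 0 1 = -1 := rfl
  have hw10 : w 1 0 = 1 := rfl
  have hw11 : w 1 1 = 0 := rfl
  have hw : ∀ g, w * h * g * (w * h)⁻¹ = w * (h * g * h⁻¹) * w⁻¹ := fun g => by group
  have e : ∀ Y : SL(2, ℝ), (w * Y * w⁻¹) 0 0 = Y 1 1 ∧ (w * Y * w⁻¹) 0 1 = - Y 1 0 ∧
      (w * Y * w⁻¹) 1 0 = - Y 0 1 := fun Y => by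
    simp [mul_apply_two, inv_apply_two, hw00, hw01, hw10, hw11, -coe_mul, -coe_inv]
  obtain ⟨g, hg, hg'⟩ := M.exists_apply_one_zero_ne_zero hx (h := w * h)
    (by rw [hw, (e _).2.2, h01, neg_zero]) (by rw [hw, (e _).2.1, h10, neg_zero]) (by
      rw [hw, (e _).1]
      have hdet := det_eq (h * x * h⁻¹)
      rw [h10, mul_zero, sub_zero] at hdet
      intro h
      apply hp
      have := congrArg (· ^ 2) hdet
      simpa [mul_pow, h, -coe_mul] using this)
  exact ⟨g, hg, fun h => hg' (by rw [hw, (e _).2.2, h, neg_zero])⟩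

/-- The Fuchsian group of a closed surface with a closed geodesic spans `M₂(ℝ)`. -/
theorem subalgebra_eq_top (M : ClosedHyperbolicSurface) {x h : SL(2, ℝ)} (hx : x ∈ M.Γ)
    (h10 : (h * x * h⁻¹) 1 0 = 0) (h01 : (h * x * h⁻¹) 0 1 = 0)
    (hp : (h * x * h⁻¹) 0 0 ^ 2 ≠ 1) {A : Subalgebra ℝ (Matrix (Fin 2) (Fin 2) ℝ)}
    (hA : ∀ g ∈ M.Γ, (g : Matrix (Fin 2) (Fin 2) ℝ) ∈ A) : A = ⊤ := by
  obtain ⟨y, hy, hy'⟩ := M.exists_apply_one_zero_ne_zero hx h10 h01 hp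
  obtain ⟨z, hz, hz'⟩ := M.exists_apply_zero_one_ne_zero hx h10 h01 hp
  have hmem : ∀ g ∈ M.Γ, ((h * g * h⁻¹ : SL(2, ℝ)) : Matrix (Fin 2) (Fin 2) ℝ) ∈
      A.comap (slConj h⁻¹) := fun g hg => by
    rw [Subalgebra.mem_comap, ← slConj_coe, slConj_inv_slConj]
    exact hA g hg
  have htop := subalgebra_eq_top_of_diag (hmem x hx) (hmem y hy) (hmem z hz) h10 h01 (by
    intro heq
    have hdet := det_eq (h * x * h⁻¹)
    rw [h10, mul_zero, sub_zero, ← heq, ← sq] at hdet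
    exact hp hdet) hy' hz'
  refine eq_top_iff.2 fun m _ => ?_
  have : slConj h m ∈ A.comap (slConj h⁻¹) := htop ▸ Algebra.mem_top
  rwa [Subalgebra.mem_comap, slConj_inv_slConj] at this

end ClosedHyperbolicSurface

/-! ### Quaternion algebras in `M₂(ℝ)` and their normalizers -/

namespace Matrix

/-- Averaging over conjugation by a quaternion basis of `M₂(ℝ)` yields a scalar matrix. -/
theorem quaternion_average {I J : Matrix (Fin 2) (Fin 2) ℝ} {a b : ℝ} (ha : a ≠ 0) (hb : b ≠ 0)
    (hI : I * I = a • 1) (hJ : J * J = b • 1) (hJI : J * I = -(I * J))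
    (hgen : Algebra.adjoin ℝ {I, J} = ⊤) (z : Matrix (Fin 2) (Fin 2) ℝ) :
    z + a⁻¹ • (I * z * I) + b⁻¹ • (J * z * J) - (a * b)⁻¹ • (I * J * z * (I * J)) =
      (2 * z.trace) • 1 := by
  set T := z + a⁻¹ • (I * z * I) + b⁻¹ • (J * z * J) - (a * b)⁻¹ • (I * J * z * (I * J)) with hT
  have hIr : ∀ m, I * (I * m) = a • m := fun m => by rw [← mul_assoc, hI]; simp
  have hJr : ∀ m, J * (J * m) = b • m := fun m => by rw [← mul_assoc, hJ]; simp
  have hJIr : ∀ m, J * (I * m) = -(I * (J * m)) := fun m => by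
    rw [← mul_assoc, hJI, neg_mul, mul_assoc]
  -- Left and right multiplication by `I` yield the same four terms in a different order; likewise
  -- for `J`. So `T` is central.
  have hTI : Commute I T := by
    simp only [commute_iff_eq, hT, mul_add, mul_sub, add_mul, sub_mul, mul_smul_comm,
      smul_mul_assoc, mul_assoc, hIr, hI, hJI, mul_neg, smul_neg, mul_one, smul_smul]
    match_scalars <;> field_simp
  have hTJ : Commute J T := by
    simp only [commute_iff_eq, hT, mul_add, mul_sub, add_mul, sub_mul, mul_smul_comm,
      smul_mul_assoc, mul_assoc, hJr, hJIr, hJ, smul_neg, mul_one, smul_smul]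
    match_scalars <;> field_simp
  have hcomm : ∀ m, Commute m T := by
    intro m
    have hm : m ∈ Algebra.adjoin ℝ {I, J} := hgen ▸ Algebra.mem_top
    have : Algebra.adjoin ℝ {I, J} ≤ Subalgebra.centralizer ℝ {T} := by
      rw [Algebra.adjoin_le_iff]
      rintro x hx
      refine (Subalgebra.mem_centralizer_iff ℝ).2 fun y hy => ?_
      rw [Set.mem_singleton_iff.1 hy]
      rcases hx with rfl | rfl
      exacts [hTI.eq.symm, hTJ.eq.symm]
    exact ((Subalgebra.mem_centralizer_iff ℝ).1 (this hm) T rfl).symm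
  have htr : T.trace = 4 * z.trace := by
    have e1 : (I * z * I).trace = a * z.trace := by
      rw [mul_assoc, trace_mul_comm, mul_assoc, hI]; simp
    have e2 : (J * z * J).trace = b * z.trace := by
      rw [mul_assoc, trace_mul_comm, mul_assoc, hJ]; simp
    have e3 : (I * J * z * (I * J)).trace = -(a * b) * z.trace := by
      rw [mul_assoc, trace_mul_comm, mul_assoc]
      rw [show I * J * (I * J) = (-(a * b)) • 1 by
        simp [mul_assoc, hJIr, hJ, hI, smul_smul, mul_comm]]
      simp
    rw [hT]
    simp only [trace_add, trace_sub, trace_smul, e1, e2, e3, smul_eq_mul]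
    field_simp
    ring
  have h1 := (hcomm !![0, 1; 0, 0]).eq
  have h2 := (hcomm !![0, 0; 1, 0]).eq
  have h00 := congrFun (congrFun h1 0) 0
  have h01 := congrFun (congrFun h1 0) 1
  have h11 := congrFun (congrFun h2 0) 0
  simp [Matrix.mul_apply, Fin.sum_univ_two] at h00 h01 h11
  rw [Matrix.trace_fin_two] at htr
  ext i j
  fin_cases i <;> fin_cases j <;> simp <;> linarith

end Matrix

namespace Submodule

/-- A `K`-subspace `S ≤ B` which spans a real vector space is all of `B` if `B` has at most the
dimension of that real vector space. -/
theorem eq_of_le_of_span_real_eq_top {K V : Type*} [Field K] [Algebra K ℝ] [AddCommGroup V]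
    [Module ℝ V] [Module K V] [IsScalarTower K ℝ V] [FiniteDimensional ℝ V] {S B : Submodule K V}
    [FiniteDimensional K B] (hle : S ≤ B) (hspan : span ℝ (S : Set V) = ⊤)
    (hrank : Module.finrank K B ≤ Module.finrank ℝ V) : S = B := by
  obtain ⟨b, hbS, hb, hli⟩ := exists_linearIndependent ℝ (S : Set V)
  have hfin : Finite b := hli.finite
  have := Fintype.ofFinite b
  have hcard : Fintype.card b = Module.finrank ℝ V := by
    have h1 := finrank_span_eq_card hli
    rw [Subtype.range_coe, hb, hspan, finrank_top] at h1
    exact h1.symm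
  have hliK : LinearIndependent K ((↑) : b → V) := hli.restrict_scalars (by
    intro x y h
    simp only [Algebra.smul_def, mul_one] at h
    exact (algebraMap K ℝ).injective h)
  have h2 := finrank_span_eq_card hliK
  rw [Subtype.range_coe] at h2
  have hbS' : span K b ≤ S := span_le.2 hbS
  have : span K b = B := eq_of_le_of_finrank_le (hbS'.trans hle) (by rw [h2, hcard]; exact hrank)
  exact le_antisymm hle (this ▸ hbS')

end Submodule

namespace QuaternionAlgebra

variable {K : IntermediateField ℚ ℝ} {a b : K}

theorem map_eq (ρ : ℍ[K,a,b] →ₐ[K] Matrix (Fin 2) (Fin 2) ℝ) (q : ℍ[K,a,b]) :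
    ρ q = (q.re : ℝ) • 1 + (q.imI : ℝ) • ρ ⟨0, 1, 0, 0⟩ + (q.imJ : ℝ) • ρ ⟨0, 0, 1, 0⟩ +
      (q.imK : ℝ) • (ρ ⟨0, 1, 0, 0⟩ * ρ ⟨0, 0, 1, 0⟩) := by
  have : q = q.re • 1 + q.imI • ⟨0, 1, 0, 0⟩ + q.imJ • ⟨0, 0, 1, 0⟩ +
      q.imK • ((⟨0, 1, 0, 0⟩ : ℍ[K,a,b]) * ⟨0, 0, 1, 0⟩) := by
    ext <;> simp
  conv_lhs => rw [this]
  simp only [map_add, map_smul, map_mul, map_one]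
  rfl

theorem map_I_mul_map_I (ρ : ℍ[K,a,b] →ₐ[K] Matrix (Fin 2) (Fin 2) ℝ) :
    ρ ⟨0, 1, 0, 0⟩ * ρ ⟨0, 1, 0, 0⟩ = (a : ℝ) • 1 := by
  rw [← map_mul, show (⟨0, 1, 0, 0⟩ : ℍ[K,a,b]) * ⟨0, 1, 0, 0⟩ = a • 1 by ext <;> simp, map_smul,
    map_one]
  rfl

theorem map_J_mul_map_J (ρ : ℍ[K,a,b] →ₐ[K] Matrix (Fin 2) (Fin 2) ℝ) :
    ρ ⟨0, 0, 1, 0⟩ * ρ ⟨0, 0, 1, 0⟩ = (b : ℝ) • 1 := by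
  rw [← map_mul, show (⟨0, 0, 1, 0⟩ : ℍ[K,a,b]) * ⟨0, 0, 1, 0⟩ = b • 1 by ext <;> simp, map_smul,
    map_one]
  rfl

theorem map_J_mul_map_I (ρ : ℍ[K,a,b] →ₐ[K] Matrix (Fin 2) (Fin 2) ℝ) :
    ρ ⟨0, 0, 1, 0⟩ * ρ ⟨0, 1, 0, 0⟩ = -(ρ ⟨0, 1, 0, 0⟩ * ρ ⟨0, 0, 1, 0⟩) := by
  rw [← map_mul, ← map_mul, ← map_neg]
  congr 1
  ext <;> simp

/-- Anticommuting invertible matrices have trace zero, since conjugating one by the other changes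
its sign; the trace of the product vanishes by cyclicity. -/
theorem trace_map (ha : a ≠ 0) (hb : b ≠ 0) (ρ : ℍ[K,a,b] →ₐ[K] Matrix (Fin 2) (Fin 2) ℝ)
    (q : ℍ[K,a,b]) : (ρ q).trace = 2 * (q.re : ℝ) := by
  have ha' : (a : ℝ) ≠ 0 := by simpa using ha
  have hb' : (b : ℝ) ≠ 0 := by simpa using hb
  have hI := map_I_mul_map_I ρ
  have hJ := map_J_mul_map_J ρ
  have hJI := map_J_mul_map_I ρ
  rw [map_eq ρ q]
  generalize ρ ⟨0, 1, 0, 0⟩ = I at *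
  generalize ρ ⟨0, 0, 1, 0⟩ = J at *
  have tI : I.trace = 0 := by
    have h1 : (J * I * J).trace = b * I.trace := by
      rw [mul_assoc, Matrix.trace_mul_comm, mul_assoc, hJ]; simp
    have h2 : (J * I * J).trace = -(b * I.trace) := by rw [hJI, neg_mul, mul_assoc, hJ]; simp
    have : (b : ℝ) * I.trace = 0 := by linarith
    exact (mul_eq_zero.1 this).resolve_left hb'
  have tJ : J.trace = 0 := by
    have h1 : (I * J * I).trace = a * J.trace := by
      rw [mul_assoc, Matrix.trace_mul_comm, mul_assoc, hI]; simp
    have h2 : (I * J * I).trace = -(a * J.trace) := by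
      rw [mul_assoc, hJI, mul_neg, ← mul_assoc, hI]; simp
    have : (a : ℝ) * J.trace = 0 := by linarith
    exact (mul_eq_zero.1 this).resolve_left ha'
  have tK : (I * J).trace = 0 := by
    have := Matrix.trace_mul_comm I J
    rw [hJI, Matrix.trace_neg] at this
    linarith
  simp [tI, tJ, tK]
  ring

theorem adjoin_eq_top (ρ : ℍ[K,a,b] →ₐ[K] Matrix (Fin 2) (Fin 2) ℝ)
    (hspan : Submodule.span ℝ (ρ.range : Set (Matrix (Fin 2) (Fin 2) ℝ)) = ⊤) :
    Algebra.adjoin ℝ {ρ ⟨0, 1, 0, 0⟩, ρ ⟨0, 0, 1, 0⟩} = ⊤ := by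
  have hI : ρ ⟨0, 1, 0, 0⟩ ∈ Algebra.adjoin ℝ {ρ ⟨0, 1, 0, 0⟩, ρ ⟨0, 0, 1, 0⟩} :=
    Algebra.subset_adjoin (by simp)
  have hJ : ρ ⟨0, 0, 1, 0⟩ ∈ Algebra.adjoin ℝ {ρ ⟨0, 1, 0, 0⟩, ρ ⟨0, 0, 1, 0⟩} :=
    Algebra.subset_adjoin (by simp)
  rw [← Algebra.toSubmodule_eq_top, eq_top_iff, ← hspan, Submodule.span_le]
  rintro _ ⟨q, rfl⟩
  change ρ q ∈ Algebra.adjoin ℝ {ρ ⟨0, 1, 0, 0⟩, ρ ⟨0, 0, 1, 0⟩}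
  rw [map_eq ρ q]
  exact add_mem (add_mem (add_mem (Subalgebra.smul_mem _ (one_mem _) _) (Subalgebra.smul_mem _ hI _))
    (Subalgebra.smul_mem _ hJ _)) (Subalgebra.smul_mem _ (mul_mem hI hJ) _)

theorem smul_mem_range {ρ : ℍ[K,a,b] →ₐ[K] Matrix (Fin 2) (Fin 2) ℝ}
    {m : Matrix (Fin 2) (Fin 2) ℝ} (hm : m ∈ ρ.range) {r : ℝ} (hr : r ∈ K) : r • m ∈ ρ.range :=
  ρ.range.smul_mem hm (⟨r, hr⟩ : K)

theorem trace_mem (ha : a ≠ 0) (hb : b ≠ 0) {ρ : ℍ[K,a,b] →ₐ[K] Matrix (Fin 2) (Fin 2) ℝ}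
    {m : Matrix (Fin 2) (Fin 2) ℝ} (hm : m ∈ ρ.range) : m.trace ∈ K := by
  obtain ⟨q, rfl⟩ := hm
  change (ρ q).trace ∈ K
  rw [trace_map ha hb]
  exact (2 * q.re).2

/-- An element of `SL(2, ℝ)` normalizing a quaternion algebra is a real multiple of an
element of the algebra. -/
theorem exists_smul_mem_range (ha : a ≠ 0) (hb : b ≠ 0)
    {ρ : ℍ[K,a,b] →ₐ[K] Matrix (Fin 2) (Fin 2) ℝ}
    (hspan : Submodule.span ℝ (ρ.range : Set (Matrix (Fin 2) (Fin 2) ℝ)) = ⊤) {g : SL(2, ℝ)}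
    (hg : ∀ y ∈ ρ.range, Matrix.slConj g y ∈ ρ.range) :
    ∃ s : ℝ, s ≠ 0 ∧ s • (g : Matrix (Fin 2) (Fin 2) ℝ) ∈ ρ.range := by
  have hgg : (g : Matrix (Fin 2) (Fin 2) ℝ) * (g⁻¹ : SL(2, ℝ)) = 1 := by
    rw [← Matrix.SpecialLinearGroup.coe_mul, mul_inv_cancel, Matrix.SpecialLinearGroup.coe_one]
  have hgg' : ((g⁻¹ : SL(2, ℝ)) : Matrix (Fin 2) (Fin 2) ℝ) * g = 1 := by
    rw [← Matrix.SpecialLinearGroup.coe_mul, inv_mul_cancel, Matrix.SpecialLinearGroup.coe_one]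
  -- The trace form cannot vanish against `g⁻¹` on a spanning set.
  obtain ⟨y, hy, hy0⟩ : ∃ y ∈ ρ.range,
      (((g⁻¹ : SL(2, ℝ)) : Matrix (Fin 2) (Fin 2) ℝ) * y).trace ≠ 0 := by
    by_contra! H
    have : Submodule.span ℝ (ρ.range : Set (Matrix (Fin 2) (Fin 2) ℝ)) ≤
        LinearMap.ker (Matrix.traceLinearMap (Fin 2) ℝ ℝ ∘ₗ
          LinearMap.mulLeft ℝ ((g⁻¹ : SL(2, ℝ)) : Matrix (Fin 2) (Fin 2) ℝ)) :=
      Submodule.span_le.2 fun y hy => H y hy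
    rw [hspan] at this
    have h1 := this (Submodule.mem_top (x := (g : Matrix (Fin 2) (Fin 2) ℝ)))
    rw [LinearMap.mem_ker, LinearMap.comp_apply, LinearMap.mulLeft_apply, hgg'] at h1
    simp at h1
  refine ⟨_, mul_ne_zero two_ne_zero hy0, ?_⟩
  have hI : ρ ⟨0, 1, 0, 0⟩ ∈ ρ.range := ⟨_, rfl⟩
  have hJ : ρ ⟨0, 0, 1, 0⟩ ∈ ρ.range := ⟨_, rfl⟩
  -- With `z = g⁻¹ y`, each term satisfies `g (e z e) = (g e g⁻¹) y e`, which lies in the algebra,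
  -- while the average is the scalar `2 tr z`.
  have hav := Matrix.quaternion_average (a := a) (b := b) (by simpa using ha) (by simpa using hb)
    (map_I_mul_map_I ρ) (map_J_mul_map_J ρ) (map_J_mul_map_I ρ) (adjoin_eq_top ρ hspan)
    (((g⁻¹ : SL(2, ℝ)) : Matrix (Fin 2) (Fin 2) ℝ) * y)
  have hmul := congrArg (fun m => (g : Matrix (Fin 2) (Fin 2) ℝ) * m) hav
  simp only [mul_smul_comm, mul_one] at hmul
  rw [← hmul]
  have hcI := hg _ hI
  have hcJ := hg _ hJ
  have hcK := hg _ (mul_mem hI hJ)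
  rw [Matrix.slConj_apply] at hcI hcJ hcK
  have ht : (g : Matrix (Fin 2) (Fin 2) ℝ) * ((g⁻¹ : SL(2, ℝ)) * y) = y := by
    rw [← mul_assoc, hgg, one_mul]
  simp only [mul_add, mul_sub, mul_smul_comm, ht]
  refine sub_mem (add_mem (add_mem hy (smul_mem_range ?_ (a⁻¹).2)) (smul_mem_range ?_ (b⁻¹).2))
    (smul_mem_range ?_ ((a * b)⁻¹).2)
  · convert mul_mem (mul_mem hcI hy) hI using 1
    simp only [mul_assoc]
  · convert mul_mem (mul_mem hcJ hy) hJ using 1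
    simp only [mul_assoc]
  · convert mul_mem (mul_mem hcK hy) (mul_mem hI hJ) using 1
    simp only [mul_assoc]

/-- If `s • g` is in the algebra, its determinant `s ^ 2` is a polynomial in traces, hence in `K`,
and can be divided out of `(s • g) ^ 2`. -/
theorem sq_mem_range (ha : a ≠ 0) (hb : b ≠ 0)
    {ρ : ℍ[K,a,b] →ₐ[K] Matrix (Fin 2) (Fin 2) ℝ}
    (hspan : Submodule.span ℝ (ρ.range : Set (Matrix (Fin 2) (Fin 2) ℝ)) = ⊤) {g : SL(2, ℝ)}
    (hg : ∀ y ∈ ρ.range, Matrix.slConj g y ∈ ρ.range) :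
    (g : Matrix (Fin 2) (Fin 2) ℝ) ^ 2 ∈ ρ.range := by
  obtain ⟨s, hs, hm⟩ := exists_smul_mem_range ha hb hspan hg
  have h1 := trace_mem ha hb hm
  have h2 := trace_mem ha hb (pow_mem hm 2)
  have h3 : s ^ 2 ∈ K := by
    have : s ^ 2 = ((s • (g : Matrix (Fin 2) (Fin 2) ℝ)).trace ^ 2 -
        ((s • (g : Matrix (Fin 2) (Fin 2) ℝ)) ^ 2).trace) / 2 := by
      rw [smul_pow, g.sq_eq, Matrix.trace_smul, Matrix.trace_smul, Matrix.trace_sub,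
        Matrix.trace_smul, Matrix.trace_fin_two]
      simp
      ring
    rw [this]
    exact div_mem (sub_mem (pow_mem h1 2) h2) (2 : K).2
  have h4 := smul_mem_range (pow_mem hm 2) (inv_mem h3)
  rwa [smul_pow, smul_smul, inv_mul_cancel₀ (pow_ne_zero 2 hs), one_smul] at h4

end QuaternionAlgebra

theorem coe_mem_range_of_mem_normOneImage {K : IntermediateField ℚ ℝ} {a b : K}
    {O : Subalgebra (NumberField.RingOfIntegers K) ℍ[K,a,b]}
    {ρ : ℍ[K,a,b] →ₐ[K] Matrix (Fin 2) (Fin 2) ℝ} {g : SL(2, ℝ)} (hg : g ∈ normOneImage O ρ) :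
    (g : Matrix (Fin 2) (Fin 2) ℝ) ∈ ρ.range := by
  obtain ⟨u, -, hu⟩ := hg
  exact ⟨_, hu⟩

/-! ### The invariant trace field lies in the field of definition -/

namespace ClosedHyperbolicSurface

open Matrix

variable {M : ClosedHyperbolicSurface} {K : IntermediateField ℚ ℝ} {a b : K}
  {O : Subalgebra (NumberField.RingOfIntegers K) ℍ[K,a,b]}
  {ρ : ℍ[K,a,b] →ₐ[K] Matrix (Fin 2) (Fin 2) ℝ}

theorem exists_pow_mem_normOneImage (hcomm : Subgroup.Commensurable M.Γ (normOneImage O ρ))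
    {g : SL(2, ℝ)} (hg : g ∈ M.Γ) : ∃ n, 0 < n ∧ g ^ n ∈ normOneImage O ρ := by
  obtain ⟨n, hn, -, h⟩ := Subgroup.exists_pow_mem_of_relIndex_ne_zero hcomm.2 hg
  exact ⟨n, hn, h.1⟩

/-- The `K`-subalgebra of the elements of `A` which stay in `A` after conjugation by an element of
the Fuchsian group spans `M₂(ℝ)`. -/
theorem span_inf_comap_eq_top (hcomm : Subgroup.Commensurable M.Γ (normOneImage O ρ))
    {x h : SL(2, ℝ)} (hx : x ∈ M.Γ) (h10 : (h * x * h⁻¹) 1 0 = 0) (h01 : (h * x * h⁻¹) 0 1 = 0)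
    (hp : (h * x * h⁻¹) 0 0 ^ 2 ≠ 1) {g : SL(2, ℝ)} (hg : g ∈ M.Γ) :
    Submodule.span ℝ ((ρ.range ⊓ ρ.range.comap ((slConj g).restrictScalars K) :
      Subalgebra K (Matrix (Fin 2) (Fin 2) ℝ)) : Set (Matrix (Fin 2) (Fin 2) ℝ)) = ⊤ := by
  set S := ρ.range ⊓ ρ.range.comap ((slConj g).restrictScalars K) with hS
  have h1 : Algebra.adjoin ℝ (S : Set (Matrix (Fin 2) (Fin 2) ℝ)) = ⊤ := by
    refine M.subalgebra_eq_top hx h10 h01 hp fun y hy => ?_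
    obtain ⟨n, hn, hyn⟩ := exists_pow_mem_normOneImage hcomm hy
    obtain ⟨m, hm, hym⟩ := exists_pow_mem_normOneImage hcomm
      (mul_mem (mul_mem hg hy) (inv_mem hg))
    -- The exponent `n * m` works for both `y` and `g y g⁻¹`; non-ellipticity then recovers `y` from
    -- this power.
    have hyS : (y : Matrix (Fin 2) (Fin 2) ℝ) ^ (n * m) ∈ S := by
      refine ⟨?_, ?_⟩
      · have := coe_mem_range_of_mem_normOneImage (pow_mem hyn m)
        rwa [← pow_mul, Matrix.SpecialLinearGroup.coe_pow] at this
      · have := coe_mem_range_of_mem_normOneImage (pow_mem hym n)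
        rw [← pow_mul, Matrix.SpecialLinearGroup.coe_pow, mul_comm m n] at this
        change slConj g _ ∈ ρ.range
        rwa [map_pow, slConj_coe]
    obtain ⟨u, v, huv⟩ := Matrix.SpecialLinearGroup.exists_eq_smul_pow_add y (M.four_le_trace_sq hy)
      (Nat.mul_pos hn hm)
    rw [huv]
    exact add_mem (Subalgebra.smul_mem _ (Algebra.subset_adjoin hyS) _)
      (Subalgebra.smul_mem _ (one_mem _) _)
  have h2 := Algebra.adjoin_eq_span ℝ (S : Set (Matrix (Fin 2) (Fin 2) ℝ))
  have h3 : Submonoid.closure (S : Set (Matrix (Fin 2) (Fin 2) ℝ)) = S.toSubmonoid :=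
    Submonoid.closure_eq S.toSubmonoid
  rw [h1, h3, Algebra.top_toSubmodule] at h2
  exact h2.symm

/-- The elements of `A` that conjugation by `g` keeps in `A` span a real space of dimension `4`,
while `A` has `K`-dimension at most `4`. So they are all of `A`, and `g` normalizes it. -/
theorem sq_mem_range (ha : a ≠ 0) (hb : b ≠ 0)
    (hcomm : Subgroup.Commensurable M.Γ (normOneImage O ρ))
    {x h : SL(2, ℝ)} (hx : x ∈ M.Γ) (h10 : (h * x * h⁻¹) 1 0 = 0) (h01 : (h * x * h⁻¹) 0 1 = 0)
    (hp : (h * x * h⁻¹) 0 0 ^ 2 ≠ 1) {g : SL(2, ℝ)} (hg : g ∈ M.Γ) :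
    (g : Matrix (Fin 2) (Fin 2) ℝ) ^ 2 ∈ ρ.range := by
  have hspan := span_inf_comap_eq_top hcomm hx h10 h01 hp hg
  have hle : ρ.range ⊓ ρ.range.comap ((slConj g).restrictScalars K) ≤ ρ.range := inf_le_left
  have hrange : Subalgebra.toSubmodule ρ.range = LinearMap.range ρ.toLinearMap := rfl
  have hfin : FiniteDimensional K (Subalgebra.toSubmodule ρ.range) := by
    rw [hrange]; infer_instance
  have heq := Submodule.eq_of_le_of_span_real_eq_top
    (S := Subalgebra.toSubmodule (ρ.range ⊓ ρ.range.comap ((slConj g).restrictScalars K)))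
    (B := Subalgebra.toSubmodule ρ.range) hle hspan (by
      rw [hrange, Module.finrank_matrix]
      refine (LinearMap.finrank_range_le _).trans ?_
      simp [QuaternionAlgebra.finrank_eq_four])
  have heq' := Subalgebra.toSubmodule_injective heq
  refine QuaternionAlgebra.sq_mem_range ha hb ?_ fun y hy => ?_
  · rwa [heq'] at hspan
  · rw [← heq'] at hy
    exact hy.2

/-- The invariant trace field of an arithmetic surface lies in its field of definition. -/
theorem traceField_le (ha : a ≠ 0) (hb : b ≠ 0)
    (hcomm : Subgroup.Commensurable M.Γ (normOneImage O ρ))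
    {x h : SL(2, ℝ)} (hx : x ∈ M.Γ) (h10 : (h * x * h⁻¹) 1 0 = 0) (h01 : (h * x * h⁻¹) 0 1 = 0)
    (hp : (h * x * h⁻¹) 0 0 ^ 2 ≠ 1) : M.traceField ≤ K := by
  refine IntermediateField.adjoin_le_iff.2 ?_
  rintro t ⟨g, hg, rfl⟩
  refine QuaternionAlgebra.trace_mem ha hb (ρ := ρ) ?_
  induction hg using Subgroup.closure_induction with
  | mem y hy =>
    obtain ⟨z, hz, rfl⟩ := hy
    rw [Matrix.SpecialLinearGroup.coe_pow]
    exact sq_mem_range ha hb hcomm hx h10 h01 hp hz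
  | one => exact one_mem _
  | mul y z _ _ hy hz => rw [Matrix.SpecialLinearGroup.coe_mul]; exact mul_mem hy hz
  | inv y _ hy =>
    have : ((y⁻¹ : SL(2, ℝ)) : Matrix (Fin 2) (Fin 2) ℝ) =
        (y : Matrix (Fin 2) (Fin 2) ℝ).trace • (1 : Matrix (Fin 2) (Fin 2) ℝ) - y := by
      rw [Matrix.SpecialLinearGroup.coe_inv, adjugate_fin_two, trace_fin_two]
      ext i j; fin_cases i <;> fin_cases j <;> simp
    rw [this]
    exact sub_mem (QuaternionAlgebra.smul_mem_range (one_mem _)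
      (QuaternionAlgebra.trace_mem ha hb hy)) hy

end ClosedHyperbolicSurface

/-! ### Norms, ramified places and conjugates -/

/-- A nonzero algebraic integer of a real number field `k` whose conjugates other than itself are
bounded by `C` is bounded below. -/
theorem IntermediateField.one_le_abs_mul_pow {k : IntermediateField ℚ ℝ} [FiniteDimensional ℚ k]
    {δ : k} (hδ : δ ≠ 0) (hint : IsIntegral ℤ δ) {C : ℝ} {ι : k →ₐ[ℚ] ℂ}
    (hι : ∀ x, ι x = ((x : ℝ) : ℂ)) (hC : ∀ σ : k →ₐ[ℚ] ℂ, σ ≠ ι → ‖σ δ‖ ≤ C) :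
    1 ≤ |(δ : ℝ)| * C ^ (Nat.card (k →ₐ[ℚ] ℂ) - 1) := by
  classical
  have h1 : (1 : ℝ) ≤ ‖((Algebra.norm ℚ δ : ℚ) : ℂ)‖ := by
    have hn : IsIntegral ℤ (Algebra.norm ℚ δ) := Algebra.isIntegral_norm ℚ hint
    obtain ⟨m, hm⟩ := IsIntegrallyClosed.isIntegral_iff.1 hn
    have hm0 : m ≠ 0 := by
      rintro rfl
      rw [map_zero, eq_comm, Algebra.norm_eq_zero_iff] at hm
      exact hδ hm
    rw [← hm]
    simpa using (mod_cast Int.one_le_abs hm0 : (1 : ℝ) ≤ |(m : ℝ)|)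
  have h2 := Algebra.norm_eq_prod_embeddings ℚ ℂ δ
  rw [eq_ratCast] at h2
  rw [h2, norm_prod, ← Finset.mul_prod_erase _ _ (Finset.mem_univ ι), hι, Complex.norm_real,
    Real.norm_eq_abs] at h1
  refine h1.trans (mul_le_mul_of_nonneg_left ?_ (abs_nonneg _))
  refine (Finset.prod_le_prod (fun σ _ => norm_nonneg _)
    fun σ hσ => hC σ (Finset.ne_of_mem_erase hσ)).trans ?_
  rw [Finset.prod_const, Finset.card_erase_of_mem (Finset.mem_univ _), Nat.card_eq_fintype_card, Finset.card_univ]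

/-- A quaternion algebra over `ℝ` isomorphic to Hamilton's is given by negative parameters. -/
theorem QuaternionAlgebra.neg_of_algEquiv {a b : ℝ} (e : ℍ[ℝ,a,b] ≃ₐ[ℝ] ℍ[ℝ]) : a < 0 ∧ b < 0 := by
  have key : ∀ {c : ℝ} {q : ℍ[ℝ,a,b]}, q * q = algebraMap ℝ _ c →
      (∀ r : ℝ, q ≠ algebraMap ℝ _ r) → c < 0 := by
    intro c q hq hne
    -- For `c ≥ 0`, the factorization `(q + √c) (q - √c) = 0` in a division algebra would make `q` a
    -- scalar.
    by_contra! hc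
    have hcm : Commute q (algebraMap ℝ ℍ[ℝ,a,b] √c) := (Algebra.commutes _ _).symm
    have h0 : (q + algebraMap ℝ ℍ[ℝ,a,b] √c) * (q - algebraMap ℝ ℍ[ℝ,a,b] √c) = 0 := by
      rw [← hcm.mul_self_sub_mul_self_eq, hq, ← map_mul, Real.mul_self_sqrt hc, sub_self]
    have h1 := congrArg e h0
    rw [map_mul, map_zero, mul_eq_zero] at h1
    rcases h1 with h1 | h1
    · rw [map_eq_zero_iff e e.injective, add_eq_zero_iff_eq_neg, ← map_neg] at h1
      exact hne _ h1
    · rw [map_eq_zero_iff e e.injective, sub_eq_zero] at h1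
      exact hne _ h1
  refine ⟨key (q := ⟨0, 1, 0, 0⟩) (by ext <;> simp [QuaternionAlgebra.algebraMap_eq]) fun r h => ?_,
    key (q := ⟨0, 0, 1, 0⟩) (by ext <;> simp [QuaternionAlgebra.algebraMap_eq]) fun r h => ?_⟩
  · simpa [QuaternionAlgebra.algebraMap_eq] using congrArg QuaternionAlgebra.imI h
  · simpa [QuaternionAlgebra.algebraMap_eq] using congrArg QuaternionAlgebra.imJ h

/-- Norm-one elements have traces bounded by `2` at ramified places. -/
theorem QuaternionAlgebra.abs_map_re_le_one {K : IntermediateField ℚ ℝ} {a b : K} {σ : K →+* ℝ}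
    (ha : σ a < 0) (hb : σ b < 0) {q : ℍ[K,a,b]} (hq : q * star q = 1) : |σ q.re| ≤ 1 := by
  have h1 := congrArg QuaternionAlgebra.re hq
  simp at h1
  have h2 := congrArg σ h1
  simp only [map_add, map_mul, map_neg, map_one] at h2
  rw [← sq_le_one_iff_abs_le_one]
  nlinarith [mul_nonneg (neg_nonneg.2 ha.le) (sq_nonneg (σ q.imI)),
    mul_nonneg (neg_nonneg.2 hb.le) (sq_nonneg (σ q.imJ)),
    mul_nonneg (mul_nonneg_of_nonpos_of_nonpos ha.le hb.le) (sq_nonneg (σ q.imK))]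

/-- `w` and `v` are the roots of `X ^ 2 - 2 s X + 1`, whose discriminant is nonpositive, so they are
complex conjugates with product `1`. -/
theorem Complex.norm_eq_one_of_add_eq_real {w v : ℂ} (hwv : w * v = 1) {s : ℝ} (hs : |s| ≤ 1)
    (h : w + v = 2 * s) : ‖w‖ = 1 := by
  have hq : w * w - 2 * s * w + 1 = 0 := by linear_combination w * h + -hwv
  have hre := congrArg Complex.re hq
  have him := congrArg Complex.im hq
  simp at hre him
  have hs2 := (sq_le_one_iff_abs_le_one s).2 hs
  have : ‖w‖ ^ 2 = 1 := by
    rw [← Complex.normSq_eq_norm_sq, Complex.normSq_apply]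
    have h1 : w.im * (w.re - s) = 0 := by linear_combination him / 2
    rcases mul_eq_zero.1 h1 with h0 | h0
    · rw [h0] at hre ⊢
      have h2 : (w.re - s) ^ 2 = 0 := le_antisymm (by nlinarith) (sq_nonneg _)
      have h3 : w.re = s := by
        rw [sq_eq_zero_iff] at h2; linarith
      rw [h3] at hre ⊢
      nlinarith
    · have h3 : w.re = s := by linarith
      rw [h3] at hre ⊢
      nlinarith
  exact (pow_eq_one_iff_of_nonneg (norm_nonneg _) two_ne_zero).1 this

/-! ### Eigenvalues of elements of arithmetic groups -/

namespace ClosedHyperbolicSurface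

open Matrix

/-- The eigenvalues of an element of an arithmetic Fuchsian group are algebraic integers. -/
theorem isIntegral_of_diag {M : ClosedHyperbolicSurface} {K : IntermediateField ℚ ℝ} {a b : K}
    [FiniteDimensional ℚ K] {O : Subalgebra (NumberField.RingOfIntegers K) ℍ[K,a,b]}
    {ρ : ℍ[K,a,b] →ₐ[K] Matrix (Fin 2) (Fin 2) ℝ} (hO : IsQuaternionOrder O)
    (hcomm : Subgroup.Commensurable M.Γ (normOneImage O ρ))
    {x h : SL(2, ℝ)} (hx : x ∈ M.Γ) (h10 : (h * x * h⁻¹) 1 0 = 0) (h01 : (h * x * h⁻¹) 0 1 = 0)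
    (i : Fin 2) : IsIntegral ℤ ((h * x * h⁻¹) i i) := by
  obtain ⟨n, hn, u, -, hu⟩ := exists_pow_mem_normOneImage hcomm hx
  refine IsIntegral.of_pow hn ?_
  have : NumberField K := ⟨⟩
  have : Module.Finite (NumberField.RingOfIntegers K) O := Module.Finite.iff_fg.2 hO.1
  have : Module.Finite ℤ O := Module.Finite.trans (NumberField.RingOfIntegers K) O
  -- The order is a finite `ℤ`-module, so the diagonal matrix of `n`-th powers of eigenvalues is
  -- integral.
  have h2 := (IsIntegral.of_finite ℤ (u : O)).map
    (((slConj h).toRingHom.comp (ρ.toRingHom.comp O.val.toRingHom)).toIntAlgHom)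
  have h3 : slConj h (ρ ((u : O) : ℍ[K,a,b])) =
      Matrix.diagonalAlgHom ℤ fun j => (h * x * h⁻¹) j j ^ n := by
    have hd : ((h * x * h⁻¹ : SL(2, ℝ)) : Matrix (Fin 2) (Fin 2) ℝ) =
        Matrix.diagonal fun j => (h * x * h⁻¹) j j := by
      ext j k
      fin_cases j <;> fin_cases k
      exacts [by simp, h01, h10, by simp]
    rw [hu, Matrix.SpecialLinearGroup.coe_pow, map_pow, slConj_coe, hd, Matrix.diagonal_pow]
    simp [Pi.pow_def]
  change IsIntegral _ (slConj h (ρ ((u : O) : ℍ[K,a,b]))) at h2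
  rw [h3, isIntegral_algHom_iff _ Matrix.diagonal_injective] at h2
  exact h2.map (Pi.evalAlgHom ℤ (fun _ : Fin 2 => ℝ) i)

theorem norm_map_trace_sq_le {M : ClosedHyperbolicSurface} {K : IntermediateField ℚ ℝ} {a b : K}
    [FiniteDimensional ℚ K] [NumberField.IsTotallyReal K]
    {O : Subalgebra (NumberField.RingOfIntegers K) ℍ[K,a,b]}
    {ρ : ℍ[K,a,b] →ₐ[K] Matrix (Fin 2) (Fin 2) ℝ} (ha : a ≠ 0) (hb : b ≠ 0)
    (hram : ∀ σ : K →+* ℝ, σ ≠ algebraMap K ℝ → Nonempty (ℍ[ℝ,σ a,σ b] ≃ₐ[ℝ] ℍ[ℝ]))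
    (hO : IsQuaternionOrder O)
    (hcomm : Subgroup.Commensurable M.Γ (normOneImage O ρ))
    {x h : SL(2, ℝ)} (hx : x ∈ M.Γ) (h10 : (h * x * h⁻¹) 1 0 = 0) (h01 : (h * x * h⁻¹) 0 1 = 0)
    (hdet : (h * x * h⁻¹) 0 0 * (h * x * h⁻¹) 1 1 = 1)
    {k : IntermediateField ℚ ℝ} (hk : k ≤ K) {y : k}
    (hy : (y : ℝ) = (h * x * h⁻¹) 0 0 ^ 2 + (h * x * h⁻¹) 1 1 ^ 2)
    {ι : k →ₐ[ℚ] ℂ} (hι : ∀ x, ι x = ((x : ℝ) : ℂ)) {σ : k →ₐ[ℚ] ℂ} (hσ : σ ≠ ι) :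
    ‖σ y‖ ≤ 2 := by
  -- Extending `σ` to all real algebraic numbers covers both `K` and the eigenvalues, which need not
  -- lie in `K`.
  let S : Set ℝ := {r | IsIntegral ℚ r}
  have hKS : K ≤ IntermediateField.adjoin ℚ S := fun r hr =>
    IntermediateField.subset_adjoin _ _
      ((Algebra.IsIntegral.isIntegral (R := ℚ) (⟨r, hr⟩ : K)).map K.val)
  obtain ⟨τ, hτ⟩ := IntermediateField.exists_algHom_adjoin_of_splits (S := S) (K := ℂ)
    (fun s hs => ⟨hs, IsAlgClosed.splits _⟩) σ (hk.trans hKS)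
  have hτσ : ∀ z : k, τ ⟨z, hKS (hk z.2)⟩ = σ z := fun z => by rw [← hτ]; rfl
  have hreal := NumberField.IsTotallyReal.complexEmbedding_isReal
    ((τ.comp (IntermediateField.inclusion hKS)).toRingHom : K →+* ℂ)
  set σ' := hreal.embedding with hσ'
  have hσ'τ : ∀ z : K, ((σ' z : ℝ) : ℂ) = τ ⟨z, hKS z.2⟩ := fun z => by
    rw [hσ', NumberField.ComplexEmbedding.IsReal.coe_embedding_apply]
    rfl
  have hne : σ' ≠ algebraMap K ℝ := by
    intro heq
    apply hσ
    ext z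
    rw [← hτσ, hι, ← hσ'τ ⟨z, hk z.2⟩, heq]
    rfl
  obtain ⟨e⟩ := hram σ' hne
  obtain ⟨hna, hnb⟩ := QuaternionAlgebra.neg_of_algEquiv e
  obtain ⟨n, hn, u, hu1, hu⟩ := exists_pow_mem_normOneImage hcomm hx
  have hbound := QuaternionAlgebra.abs_map_re_le_one hna hnb hu1
  have hint : ∀ i, (h * x * h⁻¹) i i ∈ IntermediateField.adjoin ℚ S := fun i =>
    IntermediateField.subset_adjoin _ _ (isIntegral_of_diag hO hcomm hx h10 h01 i).tower_top
  have htr : (h * x * h⁻¹) 0 0 ^ n + (h * x * h⁻¹) 1 1 ^ n =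
      2 * (((u : O) : ℍ[K,a,b]).re : ℝ) := by
    have hd : ((h * x * h⁻¹ : SL(2, ℝ)) : Matrix (Fin 2) (Fin 2) ℝ) =
        Matrix.diagonal fun j => (h * x * h⁻¹) j j := by
      ext j k
      fin_cases j <;> fin_cases k
      exacts [by simp, h01, h10, by simp]
    have h1 : (slConj h (ρ ((u : O) : ℍ[K,a,b]))).trace = (ρ ((u : O) : ℍ[K,a,b])).trace := by
      rw [slConj_apply, Matrix.trace_mul_cycle, ← Matrix.SpecialLinearGroup.coe_mul,
        inv_mul_cancel, Matrix.SpecialLinearGroup.coe_one, one_mul]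
    rw [QuaternionAlgebra.trace_map ha hb, hu, Matrix.SpecialLinearGroup.coe_pow, map_pow,
      slConj_coe, hd, Matrix.diagonal_pow, Matrix.trace_fin_two] at h1
    simpa using h1
  generalize hP : (⟨_, hint 0⟩ : IntermediateField.adjoin ℚ S) = P
  generalize hQ : (⟨_, hint 1⟩ : IntermediateField.adjoin ℚ S) = Q
  have hP' : (h * x * h⁻¹) 0 0 = P := by rw [← hP]
  have hQ' : (h * x * h⁻¹) 1 1 = Q := by rw [← hQ]
  rw [hP', hQ'] at hdet htr hy
  have hPQ : τ P * τ Q = 1 := by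
    rw [← map_mul, ← map_one τ]
    congr 1
    exact Subtype.ext hdet
  have hPQn : τ P ^ n + τ Q ^ n = 2 * (σ' ((u : O) : ℍ[K,a,b]).re : ℝ) := by
    rw [hσ'τ, ← map_pow, ← map_pow, ← map_add, ← map_ofNat τ 2, ← map_mul]
    congr 1
    exact Subtype.ext htr
  -- Only the `n`-th power of `x` is known to lie in the order, but this suffices for the absolute
  -- value.
  have hnP : ‖τ P‖ = 1 := by
    have := Complex.norm_eq_one_of_add_eq_real (by rw [← mul_pow, hPQ, one_pow]) hbound hPQn
    rwa [norm_pow, pow_eq_one_iff_of_nonneg (norm_nonneg _) hn.ne'] at this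
  have hnQ : ‖τ Q‖ = 1 := by
    have := congrArg norm hPQ
    rwa [norm_mul, hnP, one_mul, norm_one] at this
  have hσy : σ y = τ P ^ 2 + τ Q ^ 2 := by
    rw [← hτσ, ← map_pow, ← map_pow, ← map_add]
    congr 1
    exact Subtype.ext hy
  rw [hσy]
  refine (norm_add_le _ _).trans ?_
  rw [norm_pow, norm_pow, hnP, hnQ]
  norm_num

/-- For the length `l` of a closed geodesic of an arithmetic surface, `2 cosh l` is an algebraic
integer of the invariant trace field, all of whose other conjugates are bounded by `2`. -/
theorem IsArithmetic.exists_eq_two_cosh {M : ClosedHyperbolicSurface} (hM : M.IsArithmetic) {l : ℝ}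
    (hl : M.IsGeodesicLength l) {ι : M.traceField →ₐ[ℚ] ℂ} (hι : ∀ x, ι x = ((x : ℝ) : ℂ)) :
    FiniteDimensional ℚ M.traceField ∧ ∃ y : M.traceField, (y : ℝ) = Real.exp l + Real.exp (-l) ∧
      IsIntegral ℤ y ∧ ∀ σ : M.traceField →ₐ[ℚ] ℂ, σ ≠ ι → ‖σ y‖ ≤ 2 := by
  obtain ⟨x, hx, h, h10, h01, hdet, hp⟩ := hl.exists_diag
  obtain ⟨K, a, b, O, ρ, hfin, hreal, ha, hb, hram, hO, hcomm⟩ := hM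
  have hp1 : (h * x * h⁻¹) 0 0 ^ 2 ≠ 1 := by
    rw [hp]
    exact (Real.one_lt_exp_iff.2 hl.1).ne'
  have hk := traceField_le ha hb hcomm hx h10 h01 hp1
  have hq : (h * x * h⁻¹) 1 1 ^ 2 = Real.exp (-l) := by
    have := congrArg (· ^ 2) hdet
    simp only [mul_pow, one_pow, hp] at this
    rw [Real.exp_neg]
    exact eq_inv_of_mul_eq_one_right this
  have htr : (h * x * h⁻¹) 0 0 ^ 2 + (h * x * h⁻¹) 1 1 ^ 2 =
      Matrix.trace ((x ^ 2 : SL(2, ℝ)) : Matrix (Fin 2) (Fin 2) ℝ) := by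
    have h1 : (slConj h ((x ^ 2 : SL(2, ℝ)) : Matrix (Fin 2) (Fin 2) ℝ)).trace =
        Matrix.trace ((x ^ 2 : SL(2, ℝ)) : Matrix (Fin 2) (Fin 2) ℝ) := by
      rw [slConj_apply, Matrix.trace_mul_cycle, ← Matrix.SpecialLinearGroup.coe_mul,
        inv_mul_cancel, Matrix.SpecialLinearGroup.coe_one, one_mul]
    rw [← h1, Matrix.SpecialLinearGroup.coe_pow, map_pow, slConj_coe, pow_two (M := Matrix (Fin 2) (Fin 2) ℝ),
      Matrix.trace_fin_two, Matrix.mul_apply, Matrix.mul_apply, Fin.sum_univ_two,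
      Fin.sum_univ_two, h10, h01]
    ring
  have hmem : (h * x * h⁻¹) 0 0 ^ 2 + (h * x * h⁻¹) 1 1 ^ 2 ∈ M.traceField := by
    rw [htr]
    exact IntermediateField.subset_adjoin _ _
      ⟨x ^ 2, Subgroup.subset_closure ⟨x, hx, rfl⟩, rfl⟩
  refine ⟨.of_injective (IntermediateField.inclusion hk).toLinearMap
    (IntermediateField.inclusion hk).injective, ⟨_, hmem⟩, congrArg₂ (· + ·) hp hq, ?_, fun σ hσ => ?_⟩
  · rw [← isIntegral_algHom_iff (M.traceField.val.restrictScalars ℤ) M.traceField.val.injective]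
    exact ((isIntegral_of_diag hO hcomm hx h10 h01 0).pow 2).add
      ((isIntegral_of_diag hO hcomm hx h10 h01 1).pow 2)
  · exact norm_map_trace_sq_le ha hb hram hO hcomm hx h10 h01 hdet hk rfl hι hσ

end ClosedHyperbolicSurface

/-! ### From the trace gap to the length ratio -/

theorem lemma1p6 (M N : ClosedHyperbolicSurface) (hM : M.IsArithmetic) (hN : N.IsArithmetic)
    (hMN : M.traceField = N.traceField) :
    ∃ c : ℝ, 0 < c ∧ ∀ l l' : ℝ, M.IsGeodesicLength l → N.IsGeodesicLength l' → l' < l →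
      1 + c * Real.exp (-2 * l) ≤ l / l' := by
  -- Each of the other embeddings contributes at most `4 = 2 + 2` to the norm of the difference.
  refine ⟨(4 ^ (Nat.card (M.traceField →ₐ[ℚ] ℂ) - 1))⁻¹, by positivity, fun l l' hl hl' hlt => ?_⟩
  have key : (4 ^ (Nat.card (M.traceField →ₐ[ℚ] ℂ) - 1))⁻¹ ≤
      (Real.exp l + Real.exp (-l)) - (Real.exp l' + Real.exp (-l')) := by
    obtain ⟨hfin, y, hy, hyint, hyσ⟩ := hM.exists_eq_two_cosh hl
      (ι := (IsScalarTower.toAlgHom ℚ ℝ ℂ).comp M.traceField.val) fun _ => rfl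
    obtain ⟨y', hy', hyint', hyσ'⟩ : ∃ y : M.traceField, (y : ℝ) = Real.exp l' + Real.exp (-l') ∧
        IsIntegral ℤ y ∧ ∀ σ : M.traceField →ₐ[ℚ] ℂ,
          σ ≠ (IsScalarTower.toAlgHom ℚ ℝ ℂ).comp M.traceField.val → ‖σ y‖ ≤ 2 := by
      rw [hMN]
      exact (hN.exists_eq_two_cosh hl' fun _ => rfl).2
    have hpos : 0 < (Real.exp l + Real.exp (-l)) - (Real.exp l' + Real.exp (-l')) := by
      have := Real.cosh_lt_cosh.2 (show |l'| < |l| by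
        rwa [abs_of_pos hl.1, abs_of_pos hl'.1])
      rw [Real.cosh_eq, Real.cosh_eq] at this
      linarith
    have hsub : ((y - y' : M.traceField) : ℝ) =
        (Real.exp l + Real.exp (-l)) - (Real.exp l' + Real.exp (-l')) := by
      rw [← hy, ← hy']; rfl
    have h1 := IntermediateField.one_le_abs_mul_pow (δ := y - y') (C := 4)
      (by
        intro h0
        rw [h0] at hsub
        rw [← hsub] at hpos
        simp at hpos) (hyint.sub hyint') (fun _ => rfl) (fun σ hσ => by
        rw [map_sub]
        linarith [norm_sub_le (σ y) (σ y'), hyσ σ hσ, hyσ' σ hσ])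
    rw [hsub, abs_of_pos hpos] at h1
    rwa [inv_le_iff_one_le_mul₀ (by positivity)]
  generalize ((4 : ℝ) ^ (Nat.card (M.traceField →ₐ[ℚ] ℂ) - 1))⁻¹ = c at key
  have hl0 := hl'.1
  rw [le_div_iff₀ hl0]
  have h1 : Real.exp l + Real.exp (-l) - (Real.exp l' + Real.exp (-l')) ≤
      (l - l') * Real.exp l := by
    have e1 : Real.exp l' = Real.exp l * Real.exp (l' - l) := by rw [← Real.exp_add]; ring_nf
    have e2 := Real.add_one_le_exp (l' - l)
    have e3 : Real.exp (-l) ≤ Real.exp (-l') := Real.exp_le_exp.2 (by linarith)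
    have e4 := mul_le_mul_of_nonneg_left e2 (Real.exp_pos l).le
    rw [← e1] at e4
    linarith
  have h2 : l' ≤ Real.exp l := by linarith [Real.add_one_le_exp l]
  have h3 : Real.exp (-2 * l) = Real.exp (-l) * Real.exp (-l) := by
    rw [← Real.exp_add]; ring_nf
  have h4 : Real.exp (-l) * Real.exp l = 1 := by rw [← Real.exp_add]; simp
  have h5 : c * Real.exp (-l) ≤ l - l' := by
    have := mul_le_mul_of_nonneg_right (key.trans h1) (Real.exp_pos (-l)).le
    rwa [mul_assoc (l - l'), mul_comm (Real.exp l), h4, mul_one] at this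
  have h6 : Real.exp (-l) * l' ≤ 1 := by
    rw [← h4]
    exact mul_le_mul_of_nonneg_left h2 (Real.exp_pos _).le
  rw [h3]
  -- The chain is `c e ^ (-2l) l' ≤ (l - l') e ^ (-l) l' ≤ l - l'`.
  nlinarith [mul_le_mul_of_nonneg_right h5 (mul_nonneg (Real.exp_pos (-l)).le hl0.le),
    mul_le_mul_of_nonneg_left h6 (sub_pos.2 hlt).le]
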